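/- Let $q,n,d\ge 1$ and $m_1,\dots,m_q\ge 1$ be integers and put $m=m_1+\dots+m_q$. For $p=(p^{(1)},\dots,p^{(q)})$ with $p^{(k)}\in\mathbb R^{m_k+n-1}$ let $\mathcal H(p)\in\mathbb R^{m\times n}$ be the layered Hankel matrix obtained by stacking the $m_k\times n$ Hankel matrices $\big(p^{(k)}_{i+j-1}\big)_{i,j}$, $k=1,\dots,q$, on top of each other. Let block-wise constant weights $\omega_1,\dots,\omega_q\in(0,\infty]$ be given, and put $\|x\|_W^2=\sum_{k=1}^q\omega_k\sum_i (x^{(k)}_i)^2$ with $\infty\cdot 0=0$ (a weight $\infty$ means that the block is fixed). For $p$ and $R\in\mathbb R^{d\times m}$ define the cost function $$f(R)=\min\big\{\|p-\hat p\|_W^2 \;:\; \hat p,\ R\,\mathcal H(\hat p)=0,\ \|p-\hat p\|_W^2<\infty\big\}.$$ Let $G(R)\in\mathbb R^{dn\times(m+q(n-1))}$ be the matrix whose column belonging to the parameter $p^{(k)}_i$ is $\omega_k^{-1/2}\operatorname{vec}\big(R\,\mathcal H(e)\big)$, where $e$ is the corresponding unit vector and $\infty^{-1/2}=0$. Then the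 complexity of evaluating the cost function and its gradient is $O(d^3mn)$. That is, there are a single program (using integer loops, branchings and indexing, and the real operations $+,-,\times,/,\sqrt{\phantom{x}}$ in exact arithmetic) and an absolute constant $C$ such that for all sizes $q,n,d,m_1,\dots,m_q$ as above, all weights and data $p$, and all $R\in\mathbb R^{d\times m}$ for which $G(R)$ has full row rank $dn$, the following holds: the minimum defining $f(R)$ is attained, $f$ is differentiable at $R$, and the program, given $d,n,q,(m_k),p,(\omega_k^{-1}),R$, computes $f(R)$ and all entries of the gradient $\nabla f(R)\in\mathbb R^{d\times m}$ in at most $C\,d^3mn$ operations, with no division by zero and no square root of a negative number. Each real operation, assignment, branching, loop iteration and term of a sum counts as one operation. -/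

import Mathlib

noncomputable section

/-! ### A machine model: structured programs over the reals with a step count

The store holds integer arrays `int a` (cell `i`) and real arrays `real a` (cell `(i, j, k)`).  A
scalar variable is the cell `0` of an array.  A program is a finite syntactic object; it may be
run on inputs of every size.  Control flow depends on integers only, and real numbers are
accessible only through the arithmetic operations `+, -, *, /, √`. -/

/-- The memory of the machine. -/
structure Store where
  int : ℕ → ℕ → ℕ
  real : ℕ → ℕ → ℕ → ℕ → ℝ

/-- Write the integer `v` into cell `i` of the integer array `a`. -/
def Store.setInt (σ : Store) (a i v : ℕ) : Store :=
  { σ with int := fun a' i' => if a' = a ∧ i' = i then v else σ.int a' i' }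

/-- Write the real number `v` into cell `(i, j, k)` of the real array `a`. -/
def Store.setReal (σ : Store) (a i j k : ℕ) (v : ℝ) : Store :=
  { σ with real := fun a' i' j' k' =>
      if a' = a ∧ i' = i ∧ j' = j ∧ k' = k then v else σ.real a' i' j' k' }

/-- Integer (index) expressions; `sub` is truncated. -/
inductive IExp where
  | lit (n : ℕ)
  | get (a : ℕ) (i : IExp)
  | add (e₁ e₂ : IExp)
  | sub (e₁ e₂ : IExp)
  | mul (e₁ e₂ : IExp)

def IExp.eval (σ : Store) : IExp → ℕ
  | .lit n => n
  | .get a i => σ.int a (i.eval σ)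
  | .add e₁ e₂ => e₁.eval σ + e₂.eval σ
  | .sub e₁ e₂ => e₁.eval σ - e₂.eval σ
  | .mul e₁ e₂ => e₁.eval σ * e₂.eval σ

/-- Real expressions.  `iteLt i j e₁ e₂` is `e₁` if `i < j` and `e₂` otherwise;
`sum x b e` is the sum of `e` with the integer variable `x` running over `0, …, b - 1`. -/
inductive RExp where
  | lit (n : ℕ)
  | get (a : ℕ) (i j k : IExp)
  | add (e₁ e₂ : RExp)
  | sub (e₁ e₂ : RExp)
  | mul (e₁ e₂ : RExp)
  | div (e₁ e₂ : RExp)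
  | sqrt (e : RExp)
  | iteLt (i j : IExp) (e₁ e₂ : RExp)
  | sum (x : ℕ) (b : IExp) (e : RExp)

/-- The value of a real expression. -/
def RExp.eval : RExp → Store → ℝ
  | .lit n, _ => n
  | .get a i j k, σ => σ.real a (i.eval σ) (j.eval σ) (k.eval σ)
  | .add e₁ e₂, σ => e₁.eval σ + e₂.eval σ
  | .sub e₁ e₂, σ => e₁.eval σ - e₂.eval σ
  | .mul e₁ e₂, σ => e₁.eval σ * e₂.eval σ
  | .div e₁ e₂, σ => e₁.eval σ / e₂.eval σ
  | .sqrt e, σ => Real.sqrt (e.eval σ)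
  | .iteLt i j e₁ e₂, σ => if i.eval σ < j.eval σ then e₁.eval σ else e₂.eval σ
  | .sum x b e, σ => ∑ t ∈ Finset.range (b.eval σ), e.eval (σ.setInt x 0 t)

/-- The evaluation meets no division by zero and no square root of a negative number. -/
def RExp.Defined : RExp → Store → Prop
  | .lit _, _ => True
  | .get _ _ _ _, _ => True
  | .add e₁ e₂, σ => e₁.Defined σ ∧ e₂.Defined σ
  | .sub e₁ e₂, σ => e₁.Defined σ ∧ e₂.Defined σ
  | .mul e₁ e₂, σ => e₁.Defined σ ∧ e₂.Defined σ
  | .div e₁ e₂, σ => e₁.Defined σ ∧ e₂.Defined σ ∧ e₂.eval σ ≠ 0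
  | .sqrt e, σ => e.Defined σ ∧ 0 ≤ e.eval σ
  | .iteLt i j e₁ e₂, σ => if i.eval σ < j.eval σ then e₁.Defined σ else e₂.Defined σ
  | .sum x b e, σ => ∀ t < b.eval σ, e.Defined (σ.setInt x 0 t)

/-- The number of operations performed in the evaluation: one for every arithmetic operation, for
every branching and for every term of a sum. -/
def RExp.ops : RExp → Store → ℕ
  | .lit _, _ => 0
  | .get _ _ _ _, _ => 0
  | .add e₁ e₂, σ => e₁.ops σ + e₂.ops σ + 1
  | .sub e₁ e₂, σ => e₁.ops σ + e₂.ops σ + 1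
  | .mul e₁ e₂, σ => e₁.ops σ + e₂.ops σ + 1
  | .div e₁ e₂, σ => e₁.ops σ + e₂.ops σ + 1
  | .sqrt e, σ => e.ops σ + 1
  | .iteLt i j e₁ e₂, σ => (if i.eval σ < j.eval σ then e₁.ops σ else e₂.ops σ) + 1
  | .sum x b e, σ => ∑ t ∈ Finset.range (b.eval σ), (e.ops (σ.setInt x 0 t) + 1)

/-- Programs. `loop x b c` runs `c` for `x = 0, …, b - 1`, where `b` is evaluated once, on entry. -/
inductive Com where
  | skip
  | seq (c₁ c₂ : Com)
  | assignInt (a : ℕ) (i e : IExp)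
  | assignReal (a : ℕ) (i j k : IExp) (e : RExp)
  | iteLt (i j : IExp) (c₁ c₂ : Com)
  | loop (x : ℕ) (b : IExp) (c : Com)

/-- `Exec c σ σ' N`: the program `c`, started in the store `σ`, runs without an undefined
operation and stops in the store `σ'` after `N` operations.  Every assignment, every branching and
every iteration of a loop counts as one operation, in addition to the operations in the real
expressions that are evaluated. -/
inductive Exec : Com → Store → Store → ℕ → Prop
  | skip (σ : Store) : Exec .skip σ σ 0
  | seq {c₁ c₂ : Com} {σ σ₁ σ₂ : Store} {N₁ N₂ : ℕ} (h₁ : Exec c₁ σ σ₁ N₁)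
      (h₂ : Exec c₂ σ₁ σ₂ N₂) : Exec (.seq c₁ c₂) σ σ₂ (N₁ + N₂)
  | assignInt (a : ℕ) (i e : IExp) (σ : Store) :
      Exec (.assignInt a i e) σ (σ.setInt a (i.eval σ) (e.eval σ)) 1
  | assignReal (a : ℕ) (i j k : IExp) (e : RExp) (σ : Store) (h : e.Defined σ) :
      Exec (.assignReal a i j k e) σ
        (σ.setReal a (i.eval σ) (j.eval σ) (k.eval σ) (e.eval σ)) (e.ops σ + 1)
  | iteTrue {i j : IExp} {c₁ c₂ : Com} {σ σ' : Store} {N : ℕ} (h : i.eval σ < j.eval σ)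
      (h₁ : Exec c₁ σ σ' N) : Exec (.iteLt i j c₁ c₂) σ σ' (N + 1)
  | iteFalse {i j : IExp} {c₁ c₂ : Com} {σ σ' : Store} {N : ℕ} (h : ¬ i.eval σ < j.eval σ)
      (h₂ : Exec c₂ σ σ' N) : Exec (.iteLt i j c₁ c₂) σ σ' (N + 1)
  | loop {x : ℕ} {b : IExp} {c : Com} (s : ℕ → Store) (N : ℕ → ℕ)
      (h : ∀ t < b.eval (s 0), Exec c ((s t).setInt x 0 t) (s (t + 1)) (N t)) :
      Exec (.loop x b c) (s 0) (s (b.eval (s 0))) (∑ t ∈ Finset.range (b.eval (s 0)), (N t + 1))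

/-! ### Layered Hankel structures and the cost function -/

/-- Indices of the entries of `p = col (p⁽¹⁾, …, p⁽q⁾)`, where `p⁽ᵏ⁾ ∈ ℝ ^ (mₖ + n - 1)`. -/
abbrev HankelParam {q : ℕ} (m : Fin q → ℕ) (n : ℕ) : Type := Σ k : Fin q, Fin (m k + n - 1)

/-- Row indices of a layered matrix with blocks of `m₁, …, m_q` rows. -/
abbrev HankelRow {q : ℕ} (m : Fin q → ℕ) : Type := Σ k : Fin q, Fin (m k)

/-- The layered Hankel matrix: the Hankel matrices `(p⁽ᵏ⁾_{i + j})_{i, j}` (indices from `0`),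
of size `mₖ × n`, stacked on top of each other. -/
def layeredHankel {q : ℕ} (m : Fin q → ℕ) (n : ℕ) (p : HankelParam m n → ℝ) :
    Matrix (HankelRow m) (Fin n) ℝ :=
  Matrix.of fun r j => p ⟨r.1, ⟨r.2.1 + j.1, by have := r.2.2; have := j.2; omega⟩⟩

/-- The weighted squared 2-norm `∑ w x ^ 2`, with the constant weight `ω k` on the `k`-th block;
a weight may be `∞`, with `∞ * 0 = 0`. -/
def blockWeightedSq {q : ℕ} {m : Fin q → ℕ} {n : ℕ} (ω : Fin q → ENNReal)
    (x : HankelParam m n → ℝ) : ENNReal :=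
  ∑ t, ω t.1 * ENNReal.ofReal (x t ^ 2)

/-- The values of the objective `‖p - p'‖²_W` at all `p'` with `R * S(p') = 0` at which it is
finite. -/
def admissibleCosts {q : ℕ} {m : Fin q → ℕ} {n d : ℕ} (ω : Fin q → ENNReal)
    (p : HankelParam m n → ℝ) (R : Matrix (Fin d) (HankelRow m) ℝ) : Set ENNReal :=
  {c | ∃ p' : HankelParam m n → ℝ,
    R * layeredHankel m n p' = 0 ∧ c = blockWeightedSq ω (p - p') ∧ c < ⊤}

/-- The cost function `f(R)`: the minimum of `‖p - p'‖²_W` subject to `R * S(p') = 0`. -/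
def costFun {q : ℕ} {m : Fin q → ℕ} {n d : ℕ} (ω : Fin q → ENNReal)
    (p : HankelParam m n → ℝ) (R : Matrix (Fin d) (HankelRow m) ℝ) : ℝ :=
  (sInf (admissibleCosts ω p R)).toReal

/-- The matrix `G(R)`: its column with index `t` is `vec (R * S_t)`, scaled by `√(w_t⁻¹)`
(with `∞⁻¹ = 0`), where `S_t` is the value of the (linear) structure at the `t`-th unit vector. -/
def matG {q : ℕ} {m : Fin q → ℕ} (n : ℕ) {d : ℕ} (ω : Fin q → ENNReal)
    (R : Matrix (Fin d) (HankelRow m) ℝ) : Matrix (Fin n × Fin d) (HankelParam m n) ℝ :=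
  Matrix.of fun ja t =>
    (R * layeredHankel m n (Pi.single t 1)) ja.2 ja.1 * Real.sqrt ((ω t.1)⁻¹).toReal

/-- The store `σ` contains the input: the sizes `d`, `n`, `q` (integer arrays 0, 1, 2) and
`m₁, …, m_q` (integer array 3), the data `p` (real array 0), the inverse weights `ωₖ⁻¹`
(real array 1) and the matrix `R` (real array 2).  All other cells are arbitrary. -/
structure HoldsInput {q : ℕ} {m : Fin q → ℕ} {n d : ℕ} (ω : Fin q → ENNReal)
    (p : HankelParam m n → ℝ) (R : Matrix (Fin d) (HankelRow m) ℝ) (σ : Store) : Prop where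
  size_d : σ.int 0 0 = d
  size_n : σ.int 1 0 = n
  size_q : σ.int 2 0 = q
  size_m : ∀ k : Fin q, σ.int 3 k = m k
  data : ∀ t : HankelParam m n, σ.real 0 t.1 t.2 0 = p t
  weight : ∀ k : Fin q, σ.real 1 k 0 0 = ((ω k)⁻¹).toReal
  matrix : ∀ (a : Fin d) (r : HankelRow m), σ.real 2 a r.1 r.2 = R a r

end

/-! Write s = vec(R H(p)) and Γ = G Gᵀ; full row rank makes Γ positive definite. The constraint is
linear in the corrected data, so f(R) is the value of a weighted least-norm problem. If Γ y = s and
M denotes the unscaled G (`hankelMap`), the optimal data are p̂ = p - W⁻¹ Mᵀ y and f(R) = s · y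
(`weighted_least_norm`, `costFun_isLeast`). An infinite weight enters only through its inverse 0,
which leaves its block untouched.

For the gradient, freeze y at its value at R. Then f(X) = 2 s(X) · y - y · Γ(X) y + e(X) · Γ(X)⁻¹
e(X) near R, with e = s - Γ y (`quadForm_inv_expand`). Since e vanishes at R, the last term has zero
derivative, and the gradient is that of an explicit quadratic polynomial, namely 2 Y H(p̂)ᵀ with the
blocks of y as columns of Y (`costFun_hasGradientAt`). The only linear system to solve is the one
for y.

It remains to solve Γ y = s in O(d³mn). The Hankel structure and the block-wise constant weights
make Γ an n × n block Toeplitz matrix with d × d blocks (`gram_eq_toeplitz`), of block bandwidth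
min(m, n) (`column_eq_zero`). Banded Cholesky would cost d³m²n. The block Schur algorithm instead
propagates two block columns, from which every Schur complement is recoverable. Each of its n steps
costs O(m) products of d × d blocks, and it yields an L D Lᵀ factorization (`schur_invariants`,
`toeplitzBlock_eq_sum`), after which banded substitution gives y (`toeplitzBlock_solve`). The block
pivots are positive definite, hence invertible by scalar pivoting with positive pivots
(`sweep_spec`): all divisions are legitimate and no square root is taken.

The program is verified by a write-once discipline: `table` prescribes the final value of every real
cell, each assignment writes that value, and facts already established therefore persist. The costs
of the stages are summed in `program_exec`. -/

noncomputable section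

/-! ### Inversion of a positive definite matrix by principal pivot transforms -/

section Sweep

open Matrix

/-- The vector that agrees with `y` on the first `κ` indices and with `x` on the others. -/
def mixVec {d : ℕ} (κ : ℕ) (y x : Fin d → ℝ) : Fin d → ℝ := fun a => if a.1 < κ then y a else x a

/-- The principal pivot transform of `X` at the diagonal entry `k`. -/
def pivotStep {d : ℕ} (X : Matrix (Fin d) (Fin d) ℝ) (k : Fin d) : Matrix (Fin d) (Fin d) ℝ :=
  Matrix.of fun a b =>
    X a b - (X a k + if a = k then 1 else 0) * (X k b - if b = k then 1 else 0) / X k k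

/-- The matrix obtained from `P` by pivoting at the first `κ` diagonal entries. -/
def sweep {d : ℕ} [NeZero d] (P : Matrix (Fin d) (Fin d) ℝ) : ℕ → Matrix (Fin d) (Fin d) ℝ
  | 0 => P
  | κ + 1 => pivotStep (sweep P κ) (Fin.ofNat d κ)

theorem mixVec_zero {d : ℕ} (y x : Fin d → ℝ) : mixVec 0 y x = x := by
  ext a; simp [mixVec]

theorem mixVec_succ {d : ℕ} (k : Fin d) (y x : Fin d → ℝ) :
    mixVec (k.1 + 1) y x = mixVec k.1 y x + (y k - x k) • Pi.single k 1 := by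
  ext a
  by_cases h : a = k
  · subst h; simp [mixVec]
  · have : a.1 ≠ k.1 := fun e => h (Fin.ext e)
    simp only [mixVec, Pi.add_apply, Pi.smul_apply, Pi.single_apply, if_neg h, smul_zero, add_zero]
    congr 1
    exact propext ⟨fun h' => by omega, fun h' => by omega⟩

/-- The Kronecker deltas merge the four cases of a pivot (pivot entry, its row, its column, the
rest) into a single rank-one correction. -/
theorem pivotStep_mulVec {d : ℕ} (X : Matrix (Fin d) (Fin d) ℝ) (k : Fin d) (u : Fin d → ℝ)
    (a : Fin d) : (pivotStep X k *ᵥ u) a =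
      (X *ᵥ u) a - (X a k + if a = k then 1 else 0) * ((X *ᵥ u) k - u k) / X k k := by
  have h : ∀ b, pivotStep X k a b * u b = X a b * u b -
      (X a k + if a = k then 1 else 0) / X k k * (X k b * u b - if b = k then u b else 0) := by
    intro b
    simp only [pivotStep, Matrix.of_apply]
    split_ifs <;> ring
  simp only [mulVec, dotProduct, h, Finset.sum_sub_distrib, ← Finset.mul_sum,
    Finset.sum_ite_eq', Finset.mem_univ, if_true]
  ring

/-- A pivot at `k` solves the `k`-th equation of the linear relation for its `k`-th input: one more
coordinate of input and output is exchanged. -/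
theorem pivotStep_mulVec_mixVec {d : ℕ} {X : Matrix (Fin d) (Fin d) ℝ} {k : Fin d}
    {y x : Fin d → ℝ} (hX : X *ᵥ mixVec k.1 y x = mixVec k.1 x y) (hk : X k k ≠ 0) :
    pivotStep X k *ᵥ mixVec (k.1 + 1) y x = mixVec (k.1 + 1) x y := by
  have e : X *ᵥ mixVec (k.1 + 1) y x = mixVec k.1 x y + (y k - x k) • X.col k := by
    rw [mixVec_succ, mulVec_add, hX, mulVec_smul, mulVec_single_one]
  ext a
  rw [pivotStep_mulVec, e, mixVec_succ k x y]
  by_cases h : a = k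
  · subst h
    simp [mixVec]
    field_simp
    ring
  · simp [mixVec, h]
    field_simp
    ring

/-- Both claims go through one induction: the exchange needs a nonzero pivot, and positivity of the
pivot is read off from the exchange relation already reached. After all `d` exchanges the matrix
maps `P x` to `x`. -/
theorem sweep_spec {d : ℕ} [NeZero d] {P : Matrix (Fin d) (Fin d) ℝ} (hP : P.PosDef) (κ : ℕ)
    (hκ : κ ≤ d) : (∀ x, sweep P κ *ᵥ mixVec κ (P *ᵥ x) x = mixVec κ x (P *ᵥ x)) ∧
      ∀ k : Fin d, k.1 < κ → 0 < sweep P k.1 k k := by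
  induction κ with
  | zero => exact ⟨fun x => by simp [sweep, mixVec_zero], fun k hk => by omega⟩
  | succ κ ih =>
    obtain ⟨h1, h2⟩ := ih (by omega)
    set k : Fin d := ⟨κ, hκ⟩ with hk
    have hk' : Fin.ofNat d κ = k := Fin.ext (Nat.mod_eq_of_lt hκ)
    have hpos : 0 < sweep P κ k k := by
      let mx : (Fin d → ℝ) →ₗ[ℝ] (Fin d → ℝ) :=
        { toFun := fun x => mixVec κ (P *ᵥ x) x
          map_add' := fun x y => by
            ext a; simp only [mixVec, mulVec_add, Pi.add_apply]; split_ifs <;> rfl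
          map_smul' := fun c x => by
            ext a; simp only [mixVec, mulVec_smul, Pi.smul_apply]; split_ifs <;> rfl }
      have hinj : Function.Injective mx := by
        rw [← LinearMap.ker_eq_bot, LinearMap.ker_eq_bot']
        intro x hx
        have hx' : mixVec κ (P *ᵥ x) x = 0 := hx
        have h3 := h1 x
        rw [hx', mulVec_zero] at h3
        ext a
        by_cases ha : a.1 < κ
        · have := congrFun h3 a; simp [mixVec, ha] at this; exact this.symm
        · have := congrFun hx' a; simpa [mixVec, ha] using this
      -- This `x` satisfies (P x)_b = 0 for b < k, x_k = 1 and x_b = 0 for b > k. Only the term b =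
      -- k survives in x · P x, and it is the pivot.
      obtain ⟨x, hx⟩ := LinearMap.injective_iff_surjective.1 hinj (Pi.single k 1)
      have hx' : mixVec κ (P *ᵥ x) x = Pi.single k 1 := hx
      have hx0 : x ≠ 0 := by
        rintro rfl
        have := congrFun hx' k
        simp [mixVec, hk] at this
      have h4 := (posDef_iff_dotProduct_mulVec.1 hP).2 hx0
      have h5 := congrFun (h1 x) k
      rw [hx', mulVec_single_one] at h5
      have h6 : star x ⬝ᵥ P *ᵥ x = x k * (P *ᵥ x) k := by
        simp only [dotProduct, star_trivial]
        refine Finset.sum_eq_single k (fun b _ hb => ?_) (by simp)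
        have h7 := congrFun hx' b
        by_cases hb' : b.1 < κ
        · simp [mixVec, hb', hb] at h7; rw [h7, mul_zero]
        · simp [mixVec, hb', hb] at h7; rw [h7, zero_mul]
      have h8 : x k = 1 := by simpa [mixVec, hk] using congrFun hx' k
      have h9 : sweep P κ k k = (P *ᵥ x) k := by simpa [mixVec, hk] using h5
      rw [h6, h8, one_mul, ← h9] at h4
      exact h4
    refine ⟨fun x => ?_, fun j hj => ?_⟩
    · rw [sweep, hk']
      exact pivotStep_mulVec_mixVec (k := k) (h1 x) hpos.ne'
    · rcases Nat.lt_succ_iff_lt_or_eq.1 hj with h | h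
      · exact h2 j h
      · have : j = k := Fin.ext h
        rw [this]; exact hpos

theorem sweep_pivot_pos {d : ℕ} [NeZero d] {P : Matrix (Fin d) (Fin d) ℝ} (hP : P.PosDef)
    (k : Fin d) : 0 < sweep P k.1 k k :=
  (sweep_spec hP d le_rfl).2 k k.2

theorem sweep_eq_inv {d : ℕ} [NeZero d] {P : Matrix (Fin d) (Fin d) ℝ} (hP : P.PosDef) :
    sweep P d = P⁻¹ := by
  symm
  apply inv_eq_left_inv
  refine Matrix.ext_of_mulVec_single fun i => ?_
  have h := (sweep_spec hP d le_rfl).1 (Pi.single i 1)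
  have e : ∀ y x : Fin d → ℝ, mixVec d y x = y := fun y x => by ext a; simp [mixVec]
  rw [e, e] at h
  rw [← mulVec_mulVec, h, one_mulVec]

end Sweep

/-! ### The block Schur algorithm for symmetric block Toeplitz matrices -/

section Schur

open Matrix

/-- Woodbury's formula for the second pivot. It writes the inverse of the updated pivot as a sum of
two terms whose positivity is visible. -/
theorem schur_complement_mul_inv {A : Type*} [Ring A] {p pi q qi k l p'i : A} (hp : pi * p = 1)
    (hq : q * qi = 1) (hp' : (p - k * qi * l) * p'i = 1) :
    (q - l * pi * k) * (qi + qi * l * p'i * k * qi) = 1 := by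
  linear_combination (norm := noncomm_ring)
    hq * (1 + l * p'i * k * qi) + l * pi * hp' * (k * qi) - l * hp * (p'i * k * qi)

/-- The generator update is an unnormalized hyperbolic rotation: it preserves the indefinite form u
p⁻¹ u' - v q⁻¹ v', with the pivots updated too. Comparing the coefficients of u u', u v', v u' and v
v' gives `h1` to `h4`. -/
theorem schur_generator_identity {A : Type*} [Ring A] {p pi q qi k l p'i q'i u v u' v' : A}
    (hp : p * pi = 1) (hp1 : pi * p = 1) (hq : q * qi = 1) (hq1 : qi * q = 1)
    (hp' : p'i * (p - k * qi * l) = 1) (hp2 : (p - k * qi * l) * p'i = 1)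
    (hq' : (q - l * pi * k) * q'i = 1) (hq2 : q'i * (q - l * pi * k) = 1) :
    (u - v * qi * l) * p'i * (u' - k * qi * v') - (v - u * pi * k) * q'i * (v' - l * pi * u') =
      u * pi * u' - v * qi * v' := by
  have h2 : pi * k * q'i = p'i * k * qi := by
    linear_combination (norm := noncomm_ring)
      p'i * k * qi * hq' - p'i * k * hq1 * q'i - hp' * (pi * k * q'i) + p'i * hp * (k * q'i)
  have h3 : q'i * l * pi = qi * l * p'i := by
    linear_combination (norm := noncomm_ring)
      hq2 * (qi * l * p'i) - q'i * hq * (l * p'i) - q'i * l * pi * hp2 + q'i * l * hp1 * p'i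
  have h1 : p'i - pi * k * q'i * l * pi = pi := by
    linear_combination (norm := noncomm_ring) hp' * pi - p'i * hp - h2 * (l * pi)
  have h4 : qi * l * p'i * k * qi - q'i = - qi := by
    linear_combination (norm := noncomm_ring) - h3 * k * qi - hq2 * qi + q'i * hq
  linear_combination (norm := noncomm_ring)
    u * h1 * u' + u * h2 * v' + v * h3 * u' + v * h4 * v'

variable {ι : Type*} [Fintype ι]

/-- Positivity of the quadratic form of an `n × n` block matrix. -/
def BlockPosDef (n : ℕ) (S : ℕ → ℕ → Matrix ι ι ℝ) : Prop :=
  ∀ x : ℕ → ι → ℝ, (∃ r < n, x r ≠ 0) →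
    0 < ∑ r ∈ Finset.range n, ∑ c ∈ Finset.range n, x r ⬝ᵥ (S r c *ᵥ x c)

theorem BlockPosDef.posDef_zero {n : ℕ} {S : ℕ → ℕ → Matrix ι ι ℝ} (h : BlockPosDef n S)
    (hn : 0 < n) (hs : (S 0 0).IsHermitian) : (S 0 0).PosDef := by
  refine posDef_iff_dotProduct_mulVec.2 ⟨hs, fun {v} hv => ?_⟩
  have := h (fun r => if r = 0 then v else 0) ⟨0, hn, by simpa using hv⟩
  rw [Finset.sum_eq_single 0, Finset.sum_eq_single 0] at this
  · simpa using this
  · intro b _ hb; simp [hb]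
  · intro h'; simp at h'; omega
  · intro b _ hb; simp [hb]
  · intro h'; simp at h'; omega

variable [DecidableEq ι]

/-- The state after `i` steps of the block Schur algorithm: the two generators and the second
pivot. -/
def schurState (T : ℕ → Matrix ι ι ℝ) :
    ℕ → (ℕ → Matrix ι ι ℝ) × (ℕ → Matrix ι ι ℝ) × Matrix ι ι ℝ
  | 0 => (T, fun δ => T (δ + 1), T 0)
  | i + 1 =>
    let s := schurState T i
    (fun δ => s.1 δ - s.2.1 δ * (s.2.2⁻¹ * (s.2.1 0)ᵀ),
      fun δ => s.2.1 (δ + 1) - s.1 (δ + 1) * ((s.1 0)⁻¹ * s.2.1 0),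
      s.2.2 - (s.2.1 0)ᵀ * ((s.1 0)⁻¹ * s.2.1 0))

/-- The first generator: `schurA T i δ` is the block of index `i + δ` of the `i`-th column of
the (unnormalized) Cholesky factor. -/
def schurA (T : ℕ → Matrix ι ι ℝ) (i : ℕ) : ℕ → Matrix ι ι ℝ := (schurState T i).1

/-- The second generator. -/
def schurB (T : ℕ → Matrix ι ι ℝ) (i : ℕ) : ℕ → Matrix ι ι ℝ := (schurState T i).2.1

/-- The pivot of the second generator. -/
def schurQ (T : ℕ → Matrix ι ι ℝ) (i : ℕ) : Matrix ι ι ℝ := (schurState T i).2.2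

theorem schurA_succ (T : ℕ → Matrix ι ι ℝ) (i δ : ℕ) : schurA T (i + 1) δ =
    schurA T i δ - schurB T i δ * ((schurQ T i)⁻¹ * (schurB T i 0)ᵀ) := rfl

theorem schurB_succ (T : ℕ → Matrix ι ι ℝ) (i δ : ℕ) : schurB T (i + 1) δ =
    schurB T i (δ + 1) - schurA T i (δ + 1) * ((schurA T i 0)⁻¹ * schurB T i 0) := rfl

theorem schurQ_succ (T : ℕ → Matrix ι ι ℝ) (i : ℕ) : schurQ T (i + 1) =
    schurQ T i - (schurB T i 0)ᵀ * ((schurA T i 0)⁻¹ * schurB T i 0) := rfl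

/-- The recursion never widens the band, so the work per step is governed by the bandwidth. -/
theorem schur_band {T : ℕ → Matrix ι ι ℝ} {W : ℕ} (hT : ∀ δ, W ≤ δ → T δ = 0) (i : ℕ) :
    ∀ δ, W ≤ δ → schurA T i δ = 0 ∧ schurB T i δ = 0 := by
  induction i with
  | zero => exact fun δ h => ⟨hT δ h, hT (δ + 1) (by omega)⟩
  | succ i ih =>
    intro δ h
    rw [schurA_succ, schurB_succ, (ih δ h).1, (ih δ h).2, (ih (δ + 1) (by omega)).1,
      (ih (δ + 1) (by omega)).2]
    simp

/-- The blocks of the symmetric block Toeplitz matrix with first block column `T`. -/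
def toeplitzBlock (T : ℕ → Matrix ι ι ℝ) (r c : ℕ) : Matrix ι ι ℝ :=
  if c ≤ r then T (r - c) else (T (c - r))ᵀ

/-- The blocks of the successive Schur complements, indexed from zero. -/
def schurCompl (T : ℕ → Matrix ι ι ℝ) : ℕ → ℕ → ℕ → Matrix ι ι ℝ
  | 0, r, c => toeplitzBlock T r c
  | i + 1, r, c =>
    schurCompl T i r c - schurB T i r * (schurQ T i)⁻¹ * (schurB T i c)ᵀ

/-- Completing the square: prepending to `x` the minimizing first block -P⁻¹ g turns the form of `S`
into that of its Schur complement. -/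
theorem BlockPosDef.schur {n : ℕ} {S S' : ℕ → ℕ → Matrix ι ι ℝ} (h : BlockPosDef (n + 1) S)
    {L : ℕ → Matrix ι ι ℝ} (hP : (S 0 0).PosDef) (h0 : ∀ r, S (r + 1) 0 = L r)
    (h1 : ∀ c, S 0 (c + 1) = (L c)ᵀ)
    (h2 : ∀ r c, S' r c = S (r + 1) (c + 1) - L r * (S 0 0)⁻¹ * (L c)ᵀ) :
    BlockPosDef n S' := by
  intro x hx
  set P := S 0 0
  have hu : IsUnit P.det := (Matrix.isUnit_iff_isUnit_det _).1 hP.isUnit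
  have hs : Pᵀ = P := by have := hP.isHermitian; rwa [IsHermitian, conjTranspose_eq_transpose_of_trivial] at this
  have hsi : (P⁻¹)ᵀ = P⁻¹ := by rw [transpose_nonsing_inv, hs]
  set g : ι → ℝ := ∑ c ∈ Finset.range n, (L c)ᵀ *ᵥ x c with hg
  let z : ℕ → ι → ℝ := fun r => match r with
    | 0 => -(P⁻¹ *ᵥ g)
    | r + 1 => x r
  have := h z (by obtain ⟨r, hr, hxr⟩ := hx; exact ⟨r + 1, by omega, hxr⟩)
  rw [Finset.sum_range_succ'] at this
  simp only [Finset.sum_range_succ'] at this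
  have e1 : ∑ r ∈ Finset.range n, z (r + 1) ⬝ᵥ S (r + 1) 0 *ᵥ z 0 = - (g ⬝ᵥ P⁻¹ *ᵥ g) := by
    simp only [h0, z, mulVec_neg, dotProduct_neg, Finset.sum_neg_distrib]
    congr 1
    conv_rhs => rw [hg, sum_dotProduct]
    refine Finset.sum_congr rfl fun r _ => ?_
    rw [mulVec_transpose, dotProduct_mulVec]
  have e2 : ∑ c ∈ Finset.range n, z 0 ⬝ᵥ S 0 (c + 1) *ᵥ z (c + 1) = - (g ⬝ᵥ P⁻¹ *ᵥ g) := by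
    simp only [h1, z, neg_dotProduct, Finset.sum_neg_distrib]
    rw [← dotProduct_sum, ← hg, dotProduct_comm]
  have e3 : z 0 ⬝ᵥ P *ᵥ z 0 = g ⬝ᵥ P⁻¹ *ᵥ g := by
    simp only [z, mulVec_neg, dotProduct_neg, neg_dotProduct, neg_neg, mulVec_mulVec]
    rw [mul_nonsing_inv _ hu, one_mulVec, dotProduct_comm]
  have e4 : ∑ r ∈ Finset.range n, ∑ c ∈ Finset.range n, x r ⬝ᵥ (S' r c *ᵥ x c) =
      ∑ r ∈ Finset.range n, ∑ c ∈ Finset.range n, z (r + 1) ⬝ᵥ S (r + 1) (c + 1) *ᵥ z (c + 1)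
       - g ⬝ᵥ P⁻¹ *ᵥ g := by
    have : g ⬝ᵥ P⁻¹ *ᵥ g =
        ∑ r ∈ Finset.range n, ∑ c ∈ Finset.range n, x r ⬝ᵥ (L r * P⁻¹ * (L c)ᵀ) *ᵥ x c := by
      conv_lhs => rw [hg, sum_dotProduct]
      refine Finset.sum_congr rfl fun r _ => ?_
      rw [mulVec_sum, dotProduct_sum]
      refine Finset.sum_congr rfl fun c _ => ?_
      rw [mulVec_transpose (L r), ← dotProduct_mulVec, mulVec_mulVec, mulVec_mulVec, Matrix.mul_assoc]
    rw [this]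
    simp only [← Finset.sum_sub_distrib, h2, sub_mulVec, dotProduct_sub, z]
  rw [Finset.sum_add_distrib, e1, e2, e3] at this
  rw [e4]
  linarith

/-- The third claim is the displacement structure: shifting a Schur complement along the diagonal
changes it only by a form in the two generators. It holds for a Toeplitz matrix because both sides
vanish, and `schur_generator_identity` transports it to the next complement. -/
theorem schur_invariants {T : ℕ → Matrix ι ι ℝ} {n : ℕ} (hT : (T 0)ᵀ = T 0)
    (hpos : BlockPosDef n (toeplitzBlock T)) (i : ℕ) (hi : i < n) :
    (∀ r, schurCompl T i r 0 = schurA T i r) ∧ (∀ c, schurCompl T i 0 c = (schurA T i c)ᵀ) ∧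
    (∀ r c, schurCompl T i (r + 1) (c + 1) - schurCompl T i r c =
      schurA T i (r + 1) * (schurA T i 0)⁻¹ * (schurA T i (c + 1))ᵀ -
      schurB T i r * (schurQ T i)⁻¹ * (schurB T i c)ᵀ) ∧
    (schurA T i 0).PosDef ∧ (schurQ T i).PosDef ∧ BlockPosDef (n - i) (schurCompl T i) := by
  induction i with
  | zero =>
    have hP : (T 0).PosDef := by
      have := hpos.posDef_zero hi (by simpa [toeplitzBlock, IsHermitian] using hT)
      simpa [toeplitzBlock] using this
    refine ⟨fun r => by simp [schurCompl, toeplitzBlock, schurA, schurState], fun c => ?_,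
      fun r c => ?_, hP, hP, hpos⟩
    · rcases Nat.eq_zero_or_pos c with rfl | h
      · simp [schurCompl, toeplitzBlock, schurA, schurState, hT]
      · simp [schurCompl, toeplitzBlock, schurA, schurState, h.ne']
    · simp [schurCompl, toeplitzBlock, schurA, schurB, schurQ, schurState]
  | succ i ih =>
    obtain ⟨h1, h2, h3, hP, hQ, hS⟩ := ih (by omega)
    set P := schurA T i 0 with hPd
    set Q := schurQ T i with hQd
    set K := schurB T i 0 with hKd
    have tr : ∀ {M : Matrix ι ι ℝ}, M.PosDef → Mᵀ = M := fun {M} hM => by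
      have := hM.isHermitian
      rwa [IsHermitian, conjTranspose_eq_transpose_of_trivial] at this
    have un : ∀ {M : Matrix ι ι ℝ}, M.PosDef → IsUnit M.det :=
      fun hM => (Matrix.isUnit_iff_isUnit_det _).1 hM.isUnit
    have h00 : schurCompl T i 0 0 = P := h1 0
    have e1 : ∀ r, schurCompl T (i + 1) r 0 = schurA T (i + 1) r := fun r => by
      rw [schurCompl, h1, schurA_succ, Matrix.mul_assoc]
    have e2 : ∀ c, schurCompl T (i + 1) 0 c = (schurA T (i + 1) c)ᵀ := fun c => by
      rw [schurCompl, h2, schurA_succ, transpose_sub, transpose_mul, transpose_mul,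
        transpose_transpose, tr hQ.inv]
    -- `schurCompl` subtracts the contribution of the second generator without a shift. The
    -- displacement identity turns this into the usual Schur complement: shift, then subtract the
    -- contribution of the first generator.
    have e3 : ∀ r c, schurCompl T (i + 1) r c = schurCompl T i (r + 1) (c + 1) -
        schurA T i (r + 1) * P⁻¹ * (schurA T i (c + 1))ᵀ := fun r c => by
      rw [schurCompl, eq_sub_iff_add_eq, ← sub_eq_zero]
      have := h3 r c
      rw [← sub_eq_zero] at this ⊢
      linear_combination (norm := noncomm_ring) -this
    have hS' : BlockPosDef (n - (i + 1)) (schurCompl T (i + 1)) := by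
      obtain ⟨k, hk⟩ : ∃ k, n - i = k + 1 := ⟨n - i - 1, by omega⟩
      have hk' : n - (i + 1) = k := by omega
      rw [hk] at hS
      rw [hk']
      exact hS.schur (L := fun r => schurA T i (r + 1)) (by rw [h00]; exact hP)
        (fun r => h1 _) (fun c => h2 _) (fun r c => by rw [h00, e3])
    have hP' : (schurA T (i + 1) 0).PosDef := by
      rw [← e1 0]
      refine hS'.posDef_zero (by omega) ?_
      rw [IsHermitian, conjTranspose_eq_transpose_of_trivial, e1 0, ← e2 0, e1 0]
    have hPe : schurA T (i + 1) 0 = P - K * Q⁻¹ * Kᵀ := by rw [schurA_succ, Matrix.mul_assoc]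
    have hQe : schurQ T (i + 1) = Q - Kᵀ * P⁻¹ * K := by rw [schurQ_succ, Matrix.mul_assoc]
    set P' := schurA T (i + 1) 0 with hP'd
    have hQ' : (schurQ T (i + 1)).PosDef := by
      -- By `schur_complement_mul_inv` this matrix is the inverse of the next second pivot.
      have hN : (Q⁻¹ + Q⁻¹ * Kᵀ * P'⁻¹ * K * Q⁻¹).PosDef := by
        refine hQ.inv.add_posSemidef ?_
        have := hP'.inv.posSemidef.mul_mul_conjTranspose_same (Q⁻¹ * Kᵀ)
        simpa [conjTranspose_eq_transpose_of_trivial, tr hQ.inv, Matrix.mul_assoc] using this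
      have hm : schurQ T (i + 1) * (Q⁻¹ + Q⁻¹ * Kᵀ * P'⁻¹ * K * Q⁻¹) = 1 := by
        rw [hQe]
        exact schur_complement_mul_inv (nonsing_inv_mul _ (un hP)) (mul_nonsing_inv _ (un hQ))
          (by rw [← hPe]; exact mul_nonsing_inv _ (un hP'))
      rw [← inv_eq_left_inv hm]
      exact hN.inv
    refine ⟨e1, e2, fun r c => ?_, hP', hQ', hS'⟩
    rw [e3 r c]
    conv_lhs => rw [schurCompl]
    have key := schur_generator_identity (u := schurA T i (r + 1)) (v := schurB T i (r + 1))
      (u' := (schurA T i (c + 1))ᵀ) (v' := (schurB T i (c + 1))ᵀ) (k := K) (l := Kᵀ)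
      (mul_nonsing_inv _ (un hP)) (nonsing_inv_mul _ (un hP)) (mul_nonsing_inv _ (un hQ))
      (nonsing_inv_mul _ (un hQ)) (p'i := P'⁻¹) (by rw [← hPe]; exact nonsing_inv_mul _ (un hP'))
      (by rw [← hPe]; exact mul_nonsing_inv _ (un hP')) (q'i := (schurQ T (i + 1))⁻¹)
      (by rw [← hQe]; exact mul_nonsing_inv _ (un hQ'))
      (by rw [← hQe]; exact nonsing_inv_mul _ (un hQ'))
    have f1 : (schurA T (i + 1) (c + 1))ᵀ =
        (schurA T i (c + 1))ᵀ - K * Q⁻¹ * (schurB T i (c + 1))ᵀ := by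
      rw [schurA_succ, transpose_sub, transpose_mul, transpose_mul, transpose_transpose,
        tr hQ.inv]
    have f2 : (schurB T (i + 1) c)ᵀ =
        (schurB T i (c + 1))ᵀ - Kᵀ * P⁻¹ * (schurA T i (c + 1))ᵀ := by
      rw [schurB_succ, transpose_sub, transpose_mul, transpose_mul, tr hP.inv]
    rw [f1, f2, schurA_succ, schurB_succ, ← Matrix.mul_assoc, ← Matrix.mul_assoc, key]
    abel

/-- Each Schur complement is its first block column times the inverse pivot times its first block
row, plus the next complement shifted by one. Peeling these off gives L D Lᵀ. -/
theorem toeplitzBlock_eq_sum {T : ℕ → Matrix ι ι ℝ} {n : ℕ} (hT : (T 0)ᵀ = T 0)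
    (hpos : BlockPosDef n (toeplitzBlock T)) (r c : ℕ) (hr : r < n) (hc : c < n) :
    toeplitzBlock T r c = ∑ i ∈ Finset.range n, if i ≤ r ∧ i ≤ c then
      schurA T i (r - i) * (schurA T i 0)⁻¹ * (schurA T i (c - i))ᵀ else 0 := by
  have step : ∀ i, i < n → ∀ r c, schurCompl T i r c =
      schurA T i r * (schurA T i 0)⁻¹ * (schurA T i c)ᵀ +
        if 0 < r ∧ 0 < c then schurCompl T (i + 1) (r - 1) (c - 1) else 0 := by
    intro i hi r c
    obtain ⟨h1, h2, h3, hP, hQ, hS⟩ := schur_invariants hT hpos i hi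
    have hu : IsUnit (schurA T i 0).det := (Matrix.isUnit_iff_isUnit_det _).1 hP.isUnit
    have tr : (schurA T i 0)ᵀ = schurA T i 0 := by
      have := hP.isHermitian
      rwa [IsHermitian, conjTranspose_eq_transpose_of_trivial] at this
    rcases r with _ | r
    · simp [h2, mul_nonsing_inv _ hu]
    rcases c with _ | c
    · simp [h1, tr, Matrix.mul_assoc, nonsing_inv_mul _ hu]
    have := h3 r c
    simp only [Nat.succ_pos, and_self, if_true, Nat.add_sub_cancel, schurCompl]
    rw [sub_eq_iff_eq_add] at this
    rw [this]
    abel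
  have gen : ∀ k i, i + k = n → ∀ r c, i + r < n → i + c < n → schurCompl T i r c =
      ∑ j ∈ Finset.range k, if j ≤ r ∧ j ≤ c then
        schurA T (i + j) (r - j) * (schurA T (i + j) 0)⁻¹ * (schurA T (i + j) (c - j))ᵀ
        else 0 := by
    intro k
    induction k with
    | zero => intro i hi r c hr hc; omega
    | succ k ih =>
      intro i hi r c hr hc
      rw [step i (by omega) r c, Finset.sum_range_succ', add_comm]
      congr 1
      · split_ifs with h
        · rw [ih (i + 1) (by omega) _ _ (by omega) (by omega)]
          refine Finset.sum_congr rfl fun j _ => ?_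
          have e1 : (j ≤ r - 1 ∧ j ≤ c - 1) ↔ (j + 1 ≤ r ∧ j + 1 ≤ c) := by omega
          simp only [e1, show i + 1 + j = i + (j + 1) by ring, Nat.sub_sub, add_comm 1 j]
        · symm
          refine Finset.sum_eq_zero fun j _ => if_neg (by omega)
  have := gen n 0 (by simp) r c (by simpa using hr) (by simpa using hc)
  simpa [schurCompl] using this

/-- Solution of a symmetric block Toeplitz system by the block Schur algorithm. -/
theorem toeplitzBlock_solve {T : ℕ → Matrix ι ι ℝ} {n : ℕ} (hT : (T 0)ᵀ = T 0)
    (hpos : BlockPosDef n (toeplitzBlock T)) {s z y : ℕ → ι → ℝ}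
    (hz : ∀ i < n, ∑ j ∈ Finset.range (i + 1), schurA T j (i - j) *ᵥ z j = s i)
    (hy : ∀ i < n, schurA T i 0 *ᵥ z i =
      ∑ t ∈ Finset.range (n - i), (schurA T i t)ᵀ *ᵥ y (i + t)) (r : ℕ) (hr : r < n) :
    ∑ c ∈ Finset.range n, toeplitzBlock T r c *ᵥ y c = s r := by
  -- By `hy` the sum of (A_i(c - i))ᵀ y_c is P_i z_i, so the inverse pivot in the `i`-th rank-`d`
  -- term cancels.
  have e : ∀ i < n, i ≤ r →
      ∑ c ∈ Finset.range n, (if i ≤ r ∧ i ≤ c then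
        schurA T i (r - i) * (schurA T i 0)⁻¹ * (schurA T i (c - i))ᵀ else 0) *ᵥ y c =
      schurA T i (r - i) *ᵥ z i := by
    intro i hi hir
    obtain ⟨-, -, -, hP, -, -⟩ := schur_invariants hT hpos i hi
    have hu : IsUnit (schurA T i 0).det := (Matrix.isUnit_iff_isUnit_det _).1 hP.isUnit
    have : z i = (schurA T i 0)⁻¹ *ᵥ
        ∑ t ∈ Finset.range (n - i), (schurA T i t)ᵀ *ᵥ y (i + t) := by
      rw [← hy i hi, mulVec_mulVec, nonsing_inv_mul _ hu, one_mulVec]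
    rw [this, mulVec_sum, mulVec_sum]
    have hn : n = i + (n - i) := by omega
    conv_lhs => rw [hn, Finset.sum_range_add]
    rw [Finset.sum_eq_zero, zero_add]
    · refine Finset.sum_congr rfl fun t _ => ?_
      simp [hir, mulVec_mulVec, Matrix.mul_assoc]
    · intro c hc
      rw [Finset.mem_range] at hc
      rw [if_neg (by omega), zero_mulVec]
  calc ∑ c ∈ Finset.range n, toeplitzBlock T r c *ᵥ y c
      = ∑ c ∈ Finset.range n, ∑ i ∈ Finset.range n, (if i ≤ r ∧ i ≤ c then
        schurA T i (r - i) * (schurA T i 0)⁻¹ * (schurA T i (c - i))ᵀ else 0) *ᵥ y c := by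
        refine Finset.sum_congr rfl fun c hc => ?_
        rw [toeplitzBlock_eq_sum hT hpos r c hr (Finset.mem_range.1 hc), sum_mulVec]
    _ = ∑ i ∈ Finset.range n, if i ≤ r then schurA T i (r - i) *ᵥ z i else 0 := by
        rw [Finset.sum_comm]
        refine Finset.sum_congr rfl fun i hi => ?_
        split_ifs with h
        · exact e i (Finset.mem_range.1 hi) h
        · exact Finset.sum_eq_zero fun c _ => by rw [if_neg (by omega), zero_mulVec]
    _ = s r := by
        rw [← hz r hr, ← Finset.sum_filter]
        refine Finset.sum_congr ?_ fun _ _ => rfl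
        ext i
        simp only [Finset.mem_filter, Finset.mem_range]
        omega

end Schur

end

noncomputable section

/-! ### Correctness of programs that write every real cell with a prescribed final value -/

/-- `σ'` arises from `σ` by changing integer arrays with index at least `x` and by setting real
cells to the values prescribed by `F`. -/
structure Store.Ext (F : ℕ → ℕ → ℕ → ℕ → ℝ) (x : ℕ) (σ σ' : Store) : Prop where
  int : ∀ a < x, ∀ i, σ'.int a i = σ.int a i
  real : ∀ a i j k, σ'.real a i j k = σ.real a i j k ∨ σ'.real a i j k = F a i j k

namespace Store.Ext

variable {F : ℕ → ℕ → ℕ → ℕ → ℝ} {x y : ℕ} {σ σ₁ σ₂ : Store}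

theorem refl (F : ℕ → ℕ → ℕ → ℕ → ℝ) (x : ℕ) (σ : Store) : σ.Ext F x σ :=
  ⟨fun _ _ _ => rfl, fun _ _ _ _ => Or.inl rfl⟩

theorem trans (h₁ : σ.Ext F x σ₁) (h₂ : σ₁.Ext F x σ₂) : σ.Ext F x σ₂ :=
  ⟨fun a ha i => (h₂.int a ha i).trans (h₁.int a ha i), fun a i j k =>
    (h₂.real a i j k).elim (fun e => by rw [e]; exact h₁.real a i j k) Or.inr⟩

theorem mono (h : σ.Ext F x σ₁) (hyx : y ≤ x) : σ.Ext F y σ₁ :=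
  ⟨fun a ha => h.int a (ha.trans_le hyx), h.real⟩

theorem setInt (σ : Store) (i v : ℕ) : σ.Ext F x (σ.setInt x i v) :=
  ⟨fun a ha j => by simp [Store.setInt, ha.ne], fun _ _ _ _ => Or.inl rfl⟩

theorem setReal {a i j k : ℕ} {v : ℝ} (h : v = F a i j k) :
    σ.Ext F x (σ.setReal a i j k v) :=
  ⟨fun _ _ _ => rfl, fun a' i' j' k' => by
    by_cases e : a' = a ∧ i' = i ∧ j' = j ∧ k' = k
    · right
      obtain ⟨rfl, rfl, rfl, rfl⟩ := e
      simp [Store.setReal, h]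
    · left; simp [Store.setReal, e]⟩

theorem ok (h : σ.Ext F x σ₁) {a i j k : ℕ} (e : σ.real a i j k = F a i j k) :
    σ₁.real a i j k = F a i j k :=
  (h.real a i j k).elim (fun e' => e'.trans e) id

end Store.Ext

/-- Predicates that stay true when further cells get their prescribed values. -/
def Persistent (F : ℕ → ℕ → ℕ → ℕ → ℝ) (Q : Store → Prop) : Prop :=
  ∀ ⦃σ σ' : Store⦄, σ.Ext F 0 σ' → Q σ → Q σ'

theorem Persistent.ext {F : ℕ → ℕ → ℕ → ℕ → ℝ} {Q : Store → Prop} (hQ : Persistent F Q) {x : ℕ}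
    {σ σ' : Store} (h : σ.Ext F x σ') : Q σ → Q σ' :=
  hQ (h.mono (Nat.zero_le _))

/-- The program `c` runs from `σ` in at most `N` operations, leaves the integer arrays below `x`
unchanged, writes only the values prescribed by `F`, and establishes `Q`. -/
def Computes (F : ℕ → ℕ → ℕ → ℕ → ℝ) (x : ℕ) (c : Com) (σ : Store) (N : ℕ)
    (Q : Store → Prop) : Prop :=
  ∃ σ' N', Exec c σ σ' N' ∧ N' ≤ N ∧ σ.Ext F x σ' ∧ Q σ'

namespace Computes

variable {F : ℕ → ℕ → ℕ → ℕ → ℝ} {x : ℕ} {σ : Store}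

theorem weaken {c : Com} {N N' : ℕ} {Q Q' : Store → Prop} (h : Computes F x c σ N Q)
    (hN : N ≤ N') (hQ : ∀ σ', σ.Ext F x σ' → Q σ' → Q' σ') : Computes F x c σ N' Q' := by
  obtain ⟨σ', M, h1, h2, h3, h4⟩ := h
  exact ⟨σ', M, h1, h2.trans hN, h3, hQ _ h3 h4⟩

theorem seq {c₁ c₂ : Com} {N₁ N₂ : ℕ} {Q₁ Q₂ : Store → Prop} (h₁ : Computes F x c₁ σ N₁ Q₁)
    (h₂ : ∀ σ', σ.Ext F x σ' → Q₁ σ' → Computes F x c₂ σ' N₂ Q₂) :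
    Computes F x (.seq c₁ c₂) σ (N₁ + N₂) Q₂ := by
  obtain ⟨σ₁, M₁, a1, a2, a3, a4⟩ := h₁
  obtain ⟨σ₂, M₂, b1, b2, b3, b4⟩ := h₂ σ₁ a3 a4
  exact ⟨σ₂, M₁ + M₂, .seq a1 b1, by omega, a3.trans b3, b4⟩

theorem seq_le {c₁ c₂ : Com} {N₁ N : ℕ} {Q₁ Q₂ : Store → Prop} (N₂ : ℕ)
    (h₁ : Computes F x c₁ σ N₁ Q₁) (hN : N₁ + N₂ ≤ N)
    (h₂ : ∀ σ', σ.Ext F x σ' → Q₁ σ' → Computes F x c₂ σ' N₂ Q₂) :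
    Computes F x (.seq c₁ c₂) σ N Q₂ :=
  (h₁.seq h₂).weaken hN fun _ _ h => h

/-- Sequential composition that keeps the first postcondition. -/
theorem seq_and {c₁ c₂ : Com} {N₁ N₂ : ℕ} {Q₁ Q₂ : Store → Prop} (hp : Persistent F Q₁)
    (h₁ : Computes F x c₁ σ N₁ Q₁)
    (h₂ : ∀ σ', σ.Ext F x σ' → Q₁ σ' → Computes F x c₂ σ' N₂ Q₂) :
    Computes F x (.seq c₁ c₂) σ (N₁ + N₂) (fun σ' => Q₁ σ' ∧ Q₂ σ') :=
  h₁.seq fun σ' e q => (h₂ σ' e q).weaken le_rfl fun _ e' q' => ⟨hp.ext e' q, q'⟩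

theorem assignReal {a : ℕ} {i j k : IExp} {e : RExp} {N u v w : ℕ} (hu : i.eval σ = u)
    (hv : j.eval σ = v) (hw : k.eval σ = w) (hd : e.Defined σ) (hN : e.ops σ ≤ N)
    (he : e.eval σ = F a u v w) :
    Computes F x (.assignReal a i j k e) σ (N + 1) (fun σ' => σ'.real a u v w = F a u v w) := by
  refine ⟨_, _, .assignReal a i j k e σ hd, by omega, ?_, ?_⟩
  · rw [hu, hv, hw]; exact .setReal he
  · simp [Store.setReal, hu, hv, hw, he]

/-- The rule for loops: the postconditions of the iterations accumulate. -/
theorem loop {b : IExp} {B : ℕ} {c : Com} {N : ℕ → ℕ} {Q : ℕ → Store → Prop}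
    (hB : b.eval σ = B) (hQ : ∀ t, Persistent F (Q t))
    (h : ∀ t < B, ∀ σ', σ.Ext F x σ' → σ'.int x 0 = t → (∀ t' < t, Q t' σ') →
      Computes F (x + 1) c σ' (N t) (Q t)) :
    Computes F x (.loop x b c) σ (∑ t ∈ Finset.range B, (N t + 1))
      (fun σ' => ∀ t < B, Q t σ') := by
  subst hB
  -- `Exec.loop` asks for whole sequences of stores and costs; they are extended by one value per
  -- completed iteration.
  have key : ∀ T ≤ b.eval σ, ∃ (s : ℕ → Store) (M : ℕ → ℕ), s 0 = σ ∧
      (∀ t < T, Exec c ((s t).setInt x 0 t) (s (t + 1)) (M t) ∧ M t ≤ N t) ∧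
      σ.Ext F x (s T) ∧ ∀ t < T, Q t (s T) := by
    intro T
    induction T with
    | zero =>
      exact fun _ => ⟨fun _ => σ, fun _ => 0, rfl, fun t ht => by omega, .refl F x σ,
        fun t ht => by omega⟩
    | succ T ih =>
      intro hT
      obtain ⟨s, M, h0, h1, h2, h3⟩ := ih (by omega)
      have e1 : (s T).Ext F x ((s T).setInt x 0 T) := .setInt _ _ _
      obtain ⟨σ', M', g1, g2, g3, g4⟩ := h T (by omega) ((s T).setInt x 0 T) (h2.trans e1)
        (by simp [Store.setInt]) (fun t' ht' => (hQ t').ext e1 (h3 t' ht'))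
      refine ⟨Function.update s (T + 1) σ', Function.update M T M', ?_, ?_, ?_, ?_⟩
      · rw [Function.update_of_ne (by omega), h0]
      · intro t ht
        rw [Function.update_of_ne (by omega : t ≠ T + 1)]
        rcases Nat.lt_succ_iff_lt_or_eq.1 ht with ht | rfl
        · rw [Function.update_of_ne (by omega), Function.update_of_ne (by omega)]
          exact h1 t ht
        · rw [Function.update_self, Function.update_self]
          exact ⟨g1, g2⟩
      · rw [Function.update_self]
        exact h2.trans (e1.trans (g3.mono (by omega)))
      · intro t ht
        rw [Function.update_self]
        rcases Nat.lt_succ_iff_lt_or_eq.1 ht with ht | rfl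
        · exact (hQ t).ext g3 ((hQ t).ext e1 (h3 t ht))
        · exact g4
  obtain ⟨s, M, h0, h1, h2, h3⟩ := key _ le_rfl
  subst h0
  exact ⟨_, _, .loop s M fun t ht => (h1 t ht).1,
    Finset.sum_le_sum fun t ht => Nat.succ_le_succ (h1 t (Finset.mem_range.1 ht)).2, h2, h3⟩

end Computes

/-- Two nested loops around an assignment. -/
def fill2 (x : ℕ) (b₁ b₂ : IExp) (a : ℕ) (i j k : IExp) (e : RExp) : Com :=
  .loop x b₁ (.loop (x + 1) b₂ (.assignReal a i j k e))

/-- Three nested loops around an assignment. -/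
def fill3 (x : ℕ) (b₁ b₂ b₃ : IExp) (a : ℕ) (i j k : IExp) (e : RExp) : Com :=
  .loop x b₁ (fill2 (x + 1) b₂ b₃ a i j k e)

/-- The expression `e` can be evaluated in `σ` with at most `N` operations, and its value is the
one prescribed for the cell `(u, v, w)` of `a`, the indices being given by `i`, `j`, `k`. -/
structure CellSpec (F : ℕ → ℕ → ℕ → ℕ → ℝ) (σ : Store) (N a : ℕ) (i j k : IExp) (e : RExp)
    (u v w : ℕ) : Prop where
  fst : i.eval σ = u
  snd : j.eval σ = v
  trd : k.eval σ = w
  defined : e.Defined σ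
  ops : e.ops σ ≤ N
  eval : e.eval σ = F a u v w

/-- Inner bounds and costs may depend on the outer index, because the sizes m_k vary from block to
block. -/
theorem Computes.fill2 {F : ℕ → ℕ → ℕ → ℕ → ℝ} {x : ℕ} {σ : Store} {b₁ b₂ : IExp} {a : ℕ}
    {i j k : IExp} {e : RExp} {I : ℕ} {J N : ℕ → ℕ} {u v w : ℕ → ℕ → ℕ} (h₁ : b₁.eval σ = I)
    (h₂ : ∀ r < I, ∀ σ', σ.Ext F x σ' → σ'.int x 0 = r → b₂.eval σ' = J r)
    (h : ∀ r < I, ∀ s < J r, ∀ σ', σ.Ext F x σ' → σ'.int x 0 = r → σ'.int (x + 1) 0 = s →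
      CellSpec F σ' (N r) a i j k e (u r s) (v r s) (w r s)) :
    Computes F x (fill2 x b₁ b₂ a i j k e) σ (∑ r ∈ Finset.range I, (J r * (N r + 2) + 1))
      (fun σ' => ∀ r < I, ∀ s < J r,
        σ'.real a (u r s) (v r s) (w r s) = F a (u r s) (v r s) (w r s)) := by
  refine Computes.loop (N := fun r => J r * (N r + 2)) h₁
    (fun r σ₁ σ₂ e h s hs => e.ok (h s hs)) fun r hr σ₁ e₁ hi _ => ?_
  refine Computes.weaken (Computes.loop (N := fun _ => N r + 1)
    (Q := fun s σ' => σ'.real a (u r s) (v r s) (w r s) = F a (u r s) (v r s) (w r s))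
    (h₂ r hr σ₁ e₁ hi) (fun s σ₁ σ₂ e h => e.ok h) fun s hs σ₂ e₂ hj _ => ?_) (by simp)
    fun _ _ h => h
  obtain ⟨p1, p2, p3, p4, p5, p6⟩ := h r hr s hs σ₂ (e₁.trans (e₂.mono (by omega)))
    (by rw [e₂.int x (by omega), hi]) hj
  exact Computes.assignReal p1 p2 p3 p4 p5 p6

theorem Computes.fill3 {F : ℕ → ℕ → ℕ → ℕ → ℝ} {x : ℕ} {σ : Store} {b₁ b₂ b₃ : IExp} {a : ℕ}
    {i j k : IExp} {e : RExp} {I : ℕ} {J K N : ℕ → ℕ} {u v w : ℕ → ℕ → ℕ → ℕ}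
    (h₁ : b₁.eval σ = I)
    (h₂ : ∀ r < I, ∀ σ', σ.Ext F x σ' → σ'.int x 0 = r → b₂.eval σ' = J r)
    (h₃ : ∀ r < I, ∀ σ', σ.Ext F x σ' → σ'.int x 0 = r → b₃.eval σ' = K r)
    (h : ∀ r < I, ∀ s < J r, ∀ t < K r, ∀ σ', σ.Ext F x σ' → σ'.int x 0 = r →
      σ'.int (x + 1) 0 = s → σ'.int (x + 2) 0 = t →
      CellSpec F σ' (N r) a i j k e (u r s t) (v r s t) (w r s t)) :
    Computes F x (fill3 x b₁ b₂ b₃ a i j k e) σ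
      (∑ r ∈ Finset.range I, (J r * (K r * (N r + 2) + 1) + 1))
      (fun σ' => ∀ r < I, ∀ s < J r, ∀ t < K r,
        σ'.real a (u r s t) (v r s t) (w r s t) = F a (u r s t) (v r s t) (w r s t)) := by
  refine Computes.loop (N := fun r => J r * (K r * (N r + 2) + 1)) h₁
    (fun r σ₁ σ₂ e h s hs t ht => e.ok (h s hs t ht)) fun r hr σ₁ e₁ hi _ => ?_
  refine Computes.weaken (Computes.fill2 (J := fun _ => K r) (N := fun _ => N r)
    (u := u r) (v := v r) (w := w r) (h₂ r hr σ₁ e₁ hi)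
    (fun s _ σ₂ e₂ _ => h₃ r hr σ₂ (e₁.trans (e₂.mono (by omega))) ?_)
    fun s hs t ht σ₂ e₂ hj hk => h r hr s hs t ht σ₂ (e₁.trans (e₂.mono (by omega)))
      ?_ hj hk) (by simp) fun _ _ h => h
  · rw [e₂.int x (by omega), hi]
  · rw [e₂.int x (by omega), hi]

end

noncomputable section

/-! ### The cost function and its gradient -/

section WeightedLeastNorm

open Matrix

/-- Finiteness forces `x = 0` at an infinite weight, so the default value `⊤.toReal = 0` does no
harm. -/
theorem weighted_term_eq_ofReal {w : ENNReal} {x : ℝ} (h : w * ENNReal.ofReal (x ^ 2) ≠ ⊤) :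
    w * ENNReal.ofReal (x ^ 2) = ENNReal.ofReal (w.toReal * x ^ 2) ∧ (w = ⊤ → x = 0) := by
  by_cases hw : w = ⊤
  · subst hw
    have : x = 0 := by
      by_contra hx
      exact h (ENNReal.top_mul (by simpa using hx))
    simp [this]
  · exact ⟨by rw [ENNReal.ofReal_mul ENNReal.toReal_nonneg, ENNReal.ofReal_toReal hw],
      fun h' => absurd h' hw⟩

/-- For finite `w` the difference is the square w (x - l / w)²; for infinite `w` both sides vanish.
-/
theorem weighted_term_le {w : ENNReal} (hw : 0 < w) {x l : ℝ} (h : w = ⊤ → x = 0) :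
    2 * (x * l) - w⁻¹.toReal * l ^ 2 ≤ w.toReal * x ^ 2 := by
  by_cases hw' : w = ⊤
  · simp [hw', h hw']
  · have h1 : 0 < w.toReal := ENNReal.toReal_pos hw.ne' hw'
    rw [ENNReal.toReal_inv]
    have : w.toReal * x ^ 2 - (2 * (x * l) - w.toReal⁻¹ * l ^ 2) =
        w.toReal * (x - w.toReal⁻¹ * l) ^ 2 := by field_simp; ring
    nlinarith [mul_nonneg h1.le (sq_nonneg (x - w.toReal⁻¹ * l))]

theorem weighted_term_inv {w : ENNReal} (hw : 0 < w) (l : ℝ) :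
    w * ENNReal.ofReal ((w⁻¹.toReal * l) ^ 2) = ENNReal.ofReal (w⁻¹.toReal * l ^ 2) := by
  by_cases hw' : w = ⊤
  · simp [hw']
  · have h1 : 0 < w.toReal := ENNReal.toReal_pos hw.ne' hw'
    conv_lhs => rw [← ENNReal.ofReal_toReal hw']
    rw [← ENNReal.ofReal_mul h1.le, ENNReal.ofReal_toReal hw', ENNReal.toReal_inv]
    congr 1
    field_simp

/-- The weighted least-norm problem subject to linear equations, solved by a multiplier `y`. -/
theorem weighted_least_norm {κ τ : Type*} [Fintype κ] [Fintype τ] (G : Matrix κ τ ℝ)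
    {ω : τ → ENNReal} (hω : ∀ t, 0 < ω t) (p : τ → ℝ) (y : κ → ℝ)
    (hy : ∀ s, ∑ t, G s t * ((ω t)⁻¹.toReal * (y ᵥ* G) t) = (G *ᵥ p) s) :
    IsLeast {c | ∃ p' : τ → ℝ, G *ᵥ p' = 0 ∧
      c = ∑ t, ω t * ENNReal.ofReal ((p - p') t ^ 2) ∧ c < ⊤}
      (ENNReal.ofReal ((G *ᵥ p) ⬝ᵥ y)) ∧ 0 ≤ (G *ᵥ p) ⬝ᵥ y := by
  set l := y ᵥ* G with hl
  -- All feasible corrections have the same pairing with Gᵀ y; this makes the termwise lower bound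
  -- independent of the competitor.
  have hq : ∀ x : τ → ℝ, G *ᵥ x = G *ᵥ p → ∑ t, x t * l t = (G *ᵥ p) ⬝ᵥ y := fun x hx => by
    rw [← hx, dotProduct_comm, dotProduct_mulVec, ← hl, dotProduct]
    exact Finset.sum_congr rfl fun t _ => mul_comm _ _
  have hc : ∑ t, (ω t)⁻¹.toReal * l t ^ 2 = (G *ᵥ p) ⬝ᵥ y := by
    rw [← hq (fun t => (ω t)⁻¹.toReal * l t) (by ext s; exact hy s)]
    exact Finset.sum_congr rfl fun t _ => by ring
  have hn : ∀ t ∈ Finset.univ, 0 ≤ (ω t)⁻¹.toReal * l t ^ 2 := fun t _ =>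
    mul_nonneg ENNReal.toReal_nonneg (sq_nonneg _)
  refine ⟨⟨⟨fun t => p t - (ω t)⁻¹.toReal * l t, ?_, ?_, ENNReal.ofReal_lt_top⟩, ?_⟩, ?_⟩
  · ext s
    have := hy s
    simp only [mulVec, dotProduct, mul_sub, Finset.sum_sub_distrib] at this ⊢
    rw [this]; simp
  · rw [← hc, ENNReal.ofReal_sum_of_nonneg hn]
    refine Finset.sum_congr rfl fun t _ => ?_
    rw [← weighted_term_inv (hω t)]
    simp
  · rintro c ⟨p', h0, rfl, hlt⟩
    have hfin : ∀ t, ω t * ENNReal.ofReal ((p - p') t ^ 2) ≠ ⊤ := fun t =>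
      ((ENNReal.sum_lt_top.1 hlt) t (Finset.mem_univ t)).ne
    rw [Finset.sum_congr rfl fun t _ => (weighted_term_eq_ofReal (hfin t)).1,
      ← ENNReal.ofReal_sum_of_nonneg fun t _ =>
        mul_nonneg ENNReal.toReal_nonneg (sq_nonneg _)]
    refine ENNReal.ofReal_le_ofReal ?_
    have h1 := hq (p - p') (by rw [mulVec_sub, h0, sub_zero])
    calc (G *ᵥ p) ⬝ᵥ y = ∑ t, (2 * ((p - p') t * l t) - (ω t)⁻¹.toReal * l t ^ 2) := by
          rw [Finset.sum_sub_distrib, ← Finset.mul_sum, hc, h1]; ring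
      _ ≤ _ := Finset.sum_le_sum fun t _ =>
          weighted_term_le (hω t) (weighted_term_eq_ofReal (hfin t)).2
  · rw [← hc]
    exact Finset.sum_nonneg hn

end WeightedLeastNorm

/-! ### Cost, normal equations and gradient for the layered Hankel structure -/

section Hankel

open Matrix Filter Topology

variable {q : ℕ} {m : Fin q → ℕ} {n d : ℕ}

/-- The matrix of the linear map `p ↦ vec (R * layeredHankel p)`. -/
def hankelMap (n : ℕ) (R : Matrix (Fin d) (HankelRow m) ℝ) :
    Matrix (Fin n × Fin d) (HankelParam m n) ℝ :=
  Matrix.of fun ja t => (R * layeredHankel m n (Pi.single t 1)) ja.2 ja.1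

/-- `vec (R * layeredHankel p)`. -/
def hankelVec (p : HankelParam m n → ℝ) (R : Matrix (Fin d) (HankelRow m) ℝ) :
    Fin n × Fin d → ℝ := fun ja => (R * layeredHankel m n p) ja.2 ja.1

theorem hankelMap_mulVec (R : Matrix (Fin d) (HankelRow m) ℝ) (p : HankelParam m n → ℝ) :
    hankelMap n R *ᵥ p = hankelVec p R := by
  ext ⟨j, a⟩
  simp only [mulVec, dotProduct, hankelMap, hankelVec, Matrix.of_apply, mul_apply,
    Finset.sum_mul]
  rw [Finset.sum_comm]
  refine Finset.sum_congr rfl fun r _ => ?_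
  simp only [layeredHankel, Matrix.of_apply, mul_assoc, ← Finset.mul_sum]
  congr 1
  simp [Pi.single_apply]

theorem matG_eq (ω : Fin q → ENNReal) (R : Matrix (Fin d) (HankelRow m) ℝ)
    (ja : Fin n × Fin d) (t : HankelParam m n) :
    matG n ω R ja t = hankelMap n R ja t * Real.sqrt ((ω t.1)⁻¹).toReal := rfl

theorem matG_mul_transpose_apply (ω : Fin q → ENNReal) (R : Matrix (Fin d) (HankelRow m) ℝ)
    (s s' : Fin n × Fin d) : (matG n ω R * (matG n ω R)ᵀ) s s' =
      ∑ t, hankelMap n R s t * ((ω t.1)⁻¹.toReal * hankelMap n R s' t) := by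
  simp only [mul_apply, transpose_apply, matG_eq]
  refine Finset.sum_congr rfl fun t _ => ?_
  have := Real.mul_self_sqrt (ENNReal.toReal_nonneg (a := (ω t.1)⁻¹))
  linear_combination hankelMap n R s t * hankelMap n R s' t * this

theorem matG_mul_transpose_mulVec (ω : Fin q → ENNReal) (R : Matrix (Fin d) (HankelRow m) ℝ)
    (y : Fin n × Fin d → ℝ) (s : Fin n × Fin d) :
    ((matG n ω R * (matG n ω R)ᵀ) *ᵥ y) s =
      ∑ t, hankelMap n R s t * ((ω t.1)⁻¹.toReal * (y ᵥ* hankelMap n R) t) := by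
  simp only [mulVec, vecMul, dotProduct, matG_mul_transpose_apply, Finset.sum_mul,
    Finset.mul_sum]
  rw [Finset.sum_comm]
  exact Finset.sum_congr rfl fun t _ => Finset.sum_congr rfl fun s' _ => by ring

/-- Any solution of the normal equations serves as multiplier, so the formula also applies at nearby
matrices, as differentiation requires. -/
theorem costFun_isLeast {ω : Fin q → ENNReal} (hω : ∀ k, 0 < ω k) (p : HankelParam m n → ℝ)
    (R : Matrix (Fin d) (HankelRow m) ℝ) {y : Fin n × Fin d → ℝ}
    (hy : (matG n ω R * (matG n ω R)ᵀ) *ᵥ y = hankelVec p R) :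
    IsLeast (admissibleCosts ω p R) (ENNReal.ofReal (costFun ω p R)) ∧
      costFun ω p R = hankelVec p R ⬝ᵥ y := by
  have h := weighted_least_norm (hankelMap n R) (ω := fun t => ω t.1) (fun t => hω t.1) p y
    (fun s => by rw [hankelMap_mulVec, ← hy, matG_mul_transpose_mulVec])
  have e : admissibleCosts ω p R = {c | ∃ p' : HankelParam m n → ℝ, hankelMap n R *ᵥ p' = 0 ∧
      c = ∑ t, ω t.1 * ENNReal.ofReal ((p - p') t ^ 2) ∧ c < ⊤} := by
    ext c
    simp only [admissibleCosts, blockWeightedSq, Set.mem_ofPred_eq]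
    refine exists_congr fun p' => and_congr_left fun _ => ?_
    rw [hankelMap_mulVec]
    exact ⟨fun h => by ext s; simp [hankelVec, h], fun h => by
      ext a j; exact congrFun h (j, a)⟩
  rw [← e, hankelMap_mulVec] at h
  have hc : costFun ω p R = hankelVec p R ⬝ᵥ y := by
    rw [costFun, h.1.csInf_eq, ENNReal.toReal_ofReal h.2]
  exact ⟨by rw [hc]; exact h.1, hc⟩

theorem posDef_of_rank_eq {ω : Fin q → ENNReal} {R : Matrix (Fin d) (HankelRow m) ℝ}
    (h : (matG n ω R).rank = n * d) : (matG n ω R * (matG n ω R)ᵀ).PosDef := by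
  have hr : LinearIndependent ℝ (matG n ω R).row := by
    rw [linearIndependent_iff_card_eq_finrank_span, Set.finrank, ← rank_eq_finrank_span_row, h]
    simp
  have := PosDef.mul_conjTranspose_self (matG n ω R) (vecMul_injective_iff.2 hr)
  rwa [conjTranspose_eq_transpose_of_trivial] at this

/-- The product of an O(z - x) and an o(1) is o(z - x). Continuity of one factor suffices, so Γ⁻¹
never has to be differentiated. -/
theorem hasFDerivAt_mul_zero {E : Type*} [NormedAddCommGroup E] [NormedSpace ℝ E] {e φ : E → ℝ}
    {x : E} (he : DifferentiableAt ℝ e x) (he0 : e x = 0) (hφ : ContinuousAt φ x)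
    (hφ0 : φ x = 0) : HasFDerivAt (fun z => e z * φ z) (0 : E →L[ℝ] ℝ) x := by
  rw [hasFDerivAt_iff_isLittleO]
  have h1 : (fun z => e z) =O[𝓝 x] fun z => z - x := by
    simpa [he0] using he.hasFDerivAt.isBigO_sub
  have h2 : φ =o[𝓝 x] fun _ => (1 : ℝ) := by
    rw [Asymptotics.isLittleO_one_iff]
    simpa [ContinuousAt, hφ0] using hφ
  have := h1.norm_right.mul_isLittleO h2
  simp only [mul_one] at this
  simpa [he0, hφ0] using this.norm_right

/-- The matrix with the given entries. -/
def ofEntries (X : EuclideanSpace ℝ (Fin d × HankelRow m)) : Matrix (Fin d) (HankelRow m) ℝ :=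
  Matrix.of fun a r => X (a, r)

/-- The entries of `hankelMap` as linear functions of `R`. -/
def hankelMapEntry (s : Fin n × Fin d) (t : HankelParam m n) :
    EuclideanSpace ℝ (Fin d × HankelRow m) →L[ℝ] ℝ :=
  LinearMap.toContinuousLinearMap
    { toFun := fun X => hankelMap n (ofEntries X) s t
      map_add' := fun X Y => by
        simp [hankelMap, ofEntries, mul_apply, add_mul, Finset.sum_add_distrib]
      map_smul' := fun c X => by
        simp [hankelMap, ofEntries, mul_apply, mul_assoc, Finset.mul_sum] }

theorem hankelMapEntry_apply (s : Fin n × Fin d) (t : HankelParam m n)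
    (X : EuclideanSpace ℝ (Fin d × HankelRow m)) :
    hankelMapEntry s t X = hankelMap n (ofEntries X) s t := rfl

theorem quadForm_inv_expand {κ : Type*} [Fintype κ] [DecidableEq κ] {Γ : Matrix κ κ ℝ}
    (hΓ : IsUnit Γ.det) (hs : Γᵀ = Γ) (s y : κ → ℝ) :
    s ⬝ᵥ Γ⁻¹ *ᵥ s = (2 * (s ⬝ᵥ y) - y ⬝ᵥ Γ *ᵥ y) +
      (s - Γ *ᵥ y) ⬝ᵥ Γ⁻¹ *ᵥ (s - Γ *ᵥ y) := by
  have h1 : Γ⁻¹ *ᵥ (Γ *ᵥ y) = y := by rw [mulVec_mulVec, nonsing_inv_mul _ hΓ, one_mulVec]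
  have h2 : (Γ *ᵥ y) ⬝ᵥ (Γ⁻¹ *ᵥ s) = s ⬝ᵥ y := by
    rw [dotProduct_mulVec, ← mulVec_transpose, transpose_nonsing_inv, hs, h1, dotProduct_comm]
  rw [mulVec_sub, h1, sub_dotProduct, dotProduct_sub, dotProduct_sub, h2, dotProduct_comm y]
  ring

/-- With `y` frozen, Mᵀ y is linear in the matrix variable and the main part of the cost is a
quadratic polynomial in it; the remainder is quadratic in a residual that vanishes at `R`. -/
theorem costFun_hasGradientAt {ω : Fin q → ENNReal} (hω : ∀ k, 0 < ω k)
    (p : HankelParam m n → ℝ) (R : Matrix (Fin d) (HankelRow m) ℝ) {y : Fin n × Fin d → ℝ}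
    (hΓ : (matG n ω R * (matG n ω R)ᵀ).PosDef)
    (hy : (matG n ω R * (matG n ω R)ᵀ) *ᵥ y = hankelVec p R) :
    HasGradientAt (fun X : EuclideanSpace ℝ (Fin d × HankelRow m) =>
        costFun ω p (Matrix.of fun a r => X (a, r)))
      (WithLp.toLp 2 fun ar : Fin d × HankelRow m => 2 * ∑ j, y (j, ar.1) *
        layeredHankel m n (fun t => p t - (ω t.1)⁻¹.toReal * (y ᵥ* hankelMap n R) t) ar.2 j)
      (WithLp.toLp 2 fun ar : Fin d × HankelRow m => R ar.1 ar.2) := by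
  set X₀ : EuclideanSpace ℝ (Fin d × HankelRow m) :=
    WithLp.toLp 2 fun ar : Fin d × HankelRow m => R ar.1 ar.2 with hX₀
  have hR : ofEntries X₀ = R := rfl
  let Γ : EuclideanSpace ℝ (Fin d × HankelRow m) → Matrix (Fin n × Fin d) (Fin n × Fin d) ℝ :=
    fun X => matG n ω (ofEntries X) * (matG n ω (ofEntries X))ᵀ
  have hΓs : ∀ X, (Γ X)ᵀ = Γ X := fun X => by simp [Γ]
  have hΓc : Continuous Γ := by
    refine continuous_matrix fun s s' => ?_
    simp only [Γ, matG_mul_transpose_apply, ← hankelMapEntry_apply]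
    fun_prop
  have hdet : (Γ X₀).det ≠ 0 := hΓ.det_pos.ne'
  let Λ : HankelParam m n → EuclideanSpace ℝ (Fin d × HankelRow m) →L[ℝ] ℝ :=
    fun t => ∑ s, y s • hankelMapEntry s t
  have hΛ : ∀ t X, Λ t X = (y ᵥ* hankelMap n (ofEntries X)) t := fun t X => by
    simp [Λ, vecMul, dotProduct, hankelMapEntry_apply]
  let e : EuclideanSpace ℝ (Fin d × HankelRow m) → Fin n × Fin d → ℝ :=
    fun X => hankelVec p (ofEntries X) - Γ X *ᵥ y
  have he : ∀ s X, e X s = ∑ t, hankelMapEntry s t X * (p t - (ω t.1)⁻¹.toReal * Λ t X) := by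
    intro s X
    simp only [e, Pi.sub_apply, Γ, matG_mul_transpose_mulVec, ← hankelMap_mulVec, hΛ,
      hankelMapEntry_apply, mul_sub, Finset.sum_sub_distrib]
    rfl
  have hed : ∀ s, Differentiable ℝ fun X => e X s := fun s => by
    simp only [he]
    fun_prop
  have he0 : e X₀ = 0 := by
    simp only [e, Γ, hR, hy, sub_self]
  have hinv : ∀ s s', ContinuousAt (fun X => (Γ X)⁻¹ s s') X₀ := by
    intro s s'
    simp only [inv_def, Ring.inverse_eq_inv', Matrix.smul_apply, smul_eq_mul]
    refine ContinuousAt.mul ?_ ?_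
    · exact (hΓc.matrix_det.continuousAt).inv₀ hdet
    · exact (hΓc.matrix_adjugate.matrix_elem s s').continuousAt
  have hrem : HasFDerivAt (fun X => e X ⬝ᵥ (Γ X)⁻¹ *ᵥ e X)
      (0 : EuclideanSpace ℝ (Fin d × HankelRow m) →L[ℝ] ℝ) X₀ := by
    have : ∀ s ∈ (Finset.univ : Finset (Fin n × Fin d)),
        HasFDerivAt (fun X => e X s * ((Γ X)⁻¹ *ᵥ e X) s)
          (0 : EuclideanSpace ℝ (Fin d × HankelRow m) →L[ℝ] ℝ) X₀ := by
      intro s _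
      refine hasFDerivAt_mul_zero (hed s X₀) (by simp [he0]) ?_ (by simp [he0])
      simp only [mulVec, dotProduct]
      exact tendsto_finsetSum _ fun s' _ =>
        (hinv s s').mul (hed s').continuous.continuousAt
    simpa [dotProduct] using HasFDerivAt.fun_sum this
  have hlin : HasFDerivAt (fun X => ∑ t, (2 * (p t * Λ t X) - (ω t.1)⁻¹.toReal * (Λ t X) ^ 2))
      (∑ t, (2 * (p t - (ω t.1)⁻¹.toReal * Λ t X₀)) • Λ t) X₀ := by
    refine HasFDerivAt.fun_sum fun t _ => ?_
    have h1 := (Λ t).hasFDerivAt (x := X₀)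
    convert! ((h1.const_mul (p t)).const_mul 2).sub ((h1.pow 2).const_mul (ω t.1)⁻¹.toReal) using 1
    ext V
    simp
    ring
  have hexp : ∀ X, 2 * (hankelVec p (ofEntries X) ⬝ᵥ y) - y ⬝ᵥ Γ X *ᵥ y =
      ∑ t, (2 * (p t * Λ t X) - (ω t.1)⁻¹.toReal * (Λ t X) ^ 2) := by
    intro X
    rw [← hankelMap_mulVec, dotProduct_comm, dotProduct_mulVec, Finset.sum_sub_distrib,
      ← Finset.mul_sum]
    congr 1
    · simp only [hΛ, dotProduct, mul_comm]
    · have : Γ X *ᵥ y = hankelMap n (ofEntries X) *ᵥ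
          fun t => (ω t.1)⁻¹.toReal * (y ᵥ* hankelMap n (ofEntries X)) t := by
        ext s; simp only [Γ, matG_mul_transpose_mulVec]; rfl
      rw [this, dotProduct_mulVec]
      simp only [hΛ, dotProduct]
      exact Finset.sum_congr rfl fun t _ => by ring
  -- The expansion is available only where Γ is invertible, which is a neighbourhood of `X₀` by
  -- continuity of the determinant.
  have hev : (fun X : EuclideanSpace ℝ (Fin d × HankelRow m) =>
      costFun ω p (Matrix.of fun a r => X (a, r))) =ᶠ[𝓝 X₀] fun X =>
      ∑ t, (2 * (p t * Λ t X) - (ω t.1)⁻¹.toReal * (Λ t X) ^ 2) + e X ⬝ᵥ (Γ X)⁻¹ *ᵥ e X := by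
    filter_upwards [hΓc.matrix_det.continuousAt.eventually_ne hdet] with X hX
    have hu : IsUnit (Γ X).det := isUnit_iff_ne_zero.2 hX
    have h1 := (costFun_isLeast hω p (ofEntries X) (y := (Γ X)⁻¹ *ᵥ hankelVec p (ofEntries X))
      (by change Γ X *ᵥ _ = _; rw [mulVec_mulVec, mul_nonsing_inv _ hu, one_mulVec])).2
    rw [quadForm_inv_expand hu (hΓs X) _ y, hexp] at h1
    exact h1
  rw [hasGradientAt_iff_hasFDerivAt]
  refine HasFDerivAt.congr_of_eventuallyEq ?_ hev
  convert! hlin.add hrem using 1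
  rw [add_zero]
  ext V
  rw [InnerProductSpace.toDual_apply_apply]
  have hV : ∑ t, (p t - (ω t.1)⁻¹.toReal * Λ t X₀) * Λ t V = y ⬝ᵥ hankelVec
      (fun t => p t - (ω t.1)⁻¹.toReal * (y ᵥ* hankelMap n R) t) (ofEntries V) := by
    rw [← hankelMap_mulVec, dotProduct_mulVec]
    simp only [hΛ, hR, dotProduct, mul_comm]
  have hV' : (∑ t, (2 * (p t - (ω t.1)⁻¹.toReal * Λ t X₀)) • Λ t) V =
      2 * ∑ t, (p t - (ω t.1)⁻¹.toReal * Λ t X₀) * Λ t V := by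
    simp [Finset.mul_sum, mul_assoc]
  rw [hV', hV, PiLp.inner_apply]
  simp only [dotProduct, hankelVec, mul_apply, ofEntries, Matrix.of_apply, Fintype.sum_prod_type,
    Finset.mul_sum, RCLike.inner_apply, conj_trivial]
  conv_rhs => rw [Finset.sum_comm]
  refine Finset.sum_congr rfl fun a _ => ?_
  rw [Finset.sum_comm]
  exact Finset.sum_congr rfl fun j _ => Finset.sum_congr rfl fun r _ => by ring

end Hankel

end

noncomputable section

/-! ### The algorithm -/

open Matrix in
/-- Block substitution in a banded block triangular system: `x i = N i * (g i - ∑ L i t * x j)`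
with `j = i - 1 - t`, the sum running over `t < min W i`. -/
def bandSolve {ι : Type*} [Fintype ι] (W : ℕ) (N : ℕ → Matrix ι ι ℝ) (g : ℕ → ι → ℝ)
    (L : ℕ → ℕ → Matrix ι ι ℝ) (i : ℕ) : ι → ℝ :=
  N i *ᵥ (g i - ∑ t : Fin (min W i), L i t *ᵥ bandSolve W N g L (i - 1 - t))
termination_by i
decreasing_by have := t.2; omega

/-- Sizes, data, inverse weights and the matrix, as stored in the memory. -/
structure ProblemData where
  n : ℕ
  q : ℕ
  m : ℕ → ℕ
  p : ℕ → ℕ → ℕ → ℝ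
  w : ℕ → ℕ → ℕ → ℝ
  R : ℕ → ℕ → ℕ → ℝ

namespace ProblemData

open Matrix

variable (D : ProblemData) (d : ℕ) [NeZero d]

/-- The number of rows. -/
def rows : ℕ := ∑ k ∈ Finset.range D.q, D.m k

/-- The block bandwidth. -/
def width : ℕ := D.rows - (D.rows - D.n)

omit [NeZero d] in
theorem width_eq : D.width = min D.rows D.n := by unfold width; omega

/-- The first block column of `G * Gᵀ`. -/
def column (δ : ℕ) : Matrix (Fin d) (Fin d) ℝ := Matrix.of fun a b =>
  if δ < D.n then ∑ k ∈ Finset.range D.q, D.w k 0 0 *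
    ∑ r ∈ Finset.range (D.m k - δ), D.R a k r * D.R b k (r + δ) else 0

/-- The right-hand side `vec (R * S(p))`. -/
def rhs (j : ℕ) (a : Fin d) : ℝ :=
  ∑ k ∈ Finset.range D.q, ∑ r ∈ Finset.range (D.m k), D.R a k r * D.p k (r + j) 0

/-- The first generator of the Schur algorithm. -/
def genA (i δ : ℕ) : Matrix (Fin d) (Fin d) ℝ := schurA (D.column d) i δ

/-- The second generator of the Schur algorithm. -/
def genB (i δ : ℕ) : Matrix (Fin d) (Fin d) ℝ := schurB (D.column d) i δ

/-- The pivot of the second generator. -/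
def pivQ (i : ℕ) : Matrix (Fin d) (Fin d) ℝ := schurQ (D.column d) i

/-- The solution of the block lower triangular system. -/
def forward : ℕ → Fin d → ℝ :=
  bandSolve D.width (fun i => (D.genA d i 0)⁻¹) (D.rhs d) fun i t => D.genA d (i - 1 - t) (t + 1)

/-- The residuals in the forward substitution. -/
def residual (i : ℕ) : Fin d → ℝ :=
  D.rhs d i - ∑ t ∈ Finset.range (min D.width i),
    D.genA d (i - 1 - t) (t + 1) *ᵥ D.forward d (i - 1 - t)

/-- The solution of the block upper triangular system, in reverse order. -/
def backward : ℕ → Fin d → ℝ :=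
  bandSolve D.width (fun i => (D.genA d (D.n - 1 - i) 0)⁻¹)
    (fun i => D.residual d (D.n - 1 - i)) fun i t => (D.genA d (D.n - 1 - i) (t + 1))ᵀ

/-- The residuals in the backward substitution, in reverse order. -/
def residual' (i : ℕ) : Fin d → ℝ :=
  D.residual d (D.n - 1 - i) - ∑ t ∈ Finset.range (min D.width i),
    (D.genA d (D.n - 1 - i) (t + 1))ᵀ *ᵥ D.backward d (i - 1 - t)

/-- The multiplier `(G * Gᵀ)⁻¹ * vec (R * S(p))`. -/
def multiplier (j : ℕ) : Fin d → ℝ := D.backward d (D.n - 1 - j)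

/-- The value of the cost function. -/
def cost : ℝ := ∑ j ∈ Finset.range D.n, D.rhs d j ⬝ᵥ D.multiplier d j

/-- The optimal correction of `p`. -/
def corrected (k i : ℕ) : ℝ :=
  D.p k i 0 - D.w k 0 0 * ∑ a : Fin d,
    ∑ t ∈ Finset.range (D.n - (D.n - (i + 1)) - (i + 1 - D.m k)),
      D.multiplier d (i + 1 - D.m k + t) a * D.R a k (i - (i + 1 - D.m k + t))

/-- The gradient of the cost function. -/
def gradEntry (a : Fin d) (k r : ℕ) : ℝ :=
  2 * ∑ j ∈ Finset.range D.n, D.multiplier d j a * D.corrected d k (r + j)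

/-- The residue of `x` modulo `d`. -/
def residue (x : ℕ) : Fin d := ⟨x % d, Nat.mod_lt _ (NeZero.pos d)⟩

/-- The final contents of the real arrays. -/
def table (a i j k : ℕ) : ℝ :=
  let f := residue d
  match a with
  | 0 => D.p i j k
  | 1 => D.w i j k
  | 2 => D.R i j k
  | 3 => D.cost d
  | 4 => D.gradEntry d (f i) j k
  | 5 => D.rhs d i (f j)
  | 6 => D.genA d i (j / d) (f j) (f k)
  | 7 => D.genB d i (j / d) (f j) (f k)
  | 8 => sweep (D.genA d i 0) (j / d) (f j) (f k)
  | 9 => sweep (D.pivQ d i) (j / d) (f j) (f k)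
  | 10 => ((D.pivQ d i)⁻¹ * (D.genB d i 0)ᵀ) (f j) (f k)
  | 11 => ((D.genA d i 0)⁻¹ * D.genB d i 0) (f j) (f k)
  | 12 => D.residual d i (f j)
  | 13 => D.forward d i (f j)
  | 14 => D.residual' d (D.n - 1 - i) (f j)
  | 15 => D.multiplier d i (f j)
  | 16 => D.corrected d i j
  | _ => 0

/-- Decodes the storage of a stack of blocks in one array. In arrays 8 and 9 the block number counts
pivots, so block 0 is the matrix and block `d` its inverse. -/
theorem residue_mul_add (δ : ℕ) (a : Fin d) : residue d (δ * d + a) = a := by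
  ext; simp [residue, Nat.mod_eq_of_lt a.2]

omit [NeZero d] in
theorem mul_add_div (δ : ℕ) (a : Fin d) : (δ * d + a) / d = δ := by
  rw [mul_comm, Nat.mul_add_div a.pos, Nat.div_eq_of_lt a.2, add_zero]

theorem residue_val (a : Fin d) : residue d a = a := by
  ext; simp [residue, Nat.mod_eq_of_lt a.2]

theorem ofNat_val (a : Fin d) : Fin.ofNat d a.1 = a := by
  ext; simp [Fin.ofNat, Nat.mod_eq_of_lt a.2]

omit [NeZero d] in
theorem val_div (a : Fin d) : a.1 / d = 0 := Nat.div_eq_of_lt a.2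

end ProblemData

namespace HankelProgram

/-- The integer variable `x`. -/
abbrev var (x : ℕ) : IExp := .get x (.lit 0)

/-- The number of rows of `R`. -/
abbrev dimE : IExp := var 0

/-- The number of columns of the Hankel matrix. -/
abbrev colsE : IExp := var 1

/-- The number of blocks. -/
abbrev blocksE : IExp := var 2

/-- The block bandwidth. -/
abbrev widthE : IExp := .sub (var 4) (.sub (var 4) colsE)

/-- The row `a` of the block `δ`. -/
abbrev rowE (δ a : IExp) : IExp := .add (.mul δ dimE) a

/-- `δ` plus one. -/
abbrev succE (δ : IExp) : IExp := .add δ (.lit 1)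

/-- The minimum of `a` and `b`. -/
abbrev minE (a b : IExp) : IExp := .sub a (.sub a b)

/-- The computation of the number of rows. -/
def rowsCom : Com :=
  .seq (.assignInt 4 (.lit 0) (.lit 0))
    (.loop 5 blocksE (.assignInt 4 (.lit 0) (.add (var 4) (.get 3 (var 5)))))

/-- The right-hand side. -/
def rhsCom : Com :=
  fill2 5 colsE dimE 5 (var 5) (var 6) (.lit 0)
    (.sum 9 blocksE (.sum 10 (.get 3 (var 9))
      (.mul (.get 2 (var 6) (var 9) (var 10)) (.get 0 (var 9) (.add (var 10) (var 5)) (.lit 0)))))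

/-- An entry of the first block column of the Toeplitz matrix. -/
def columnE (δ a b : IExp) : RExp :=
  .iteLt δ colsE (.sum 9 blocksE (.mul (.get 1 (var 9) (.lit 0) (.lit 0))
    (.sum 10 (.sub (.get 3 (var 9)) δ)
      (.mul (.get 2 a (var 9) (var 10)) (.get 2 b (var 9) (.add (var 10) δ)))))) (.lit 0)

/-- The initial generators and pivot. -/
def initCom : Com :=
  .seq (fill3 5 (succE widthE) dimE dimE 6 (.lit 0) (rowE (var 5) (var 6)) (var 7)
    (columnE (var 5) (var 6) (var 7)))
  (.seq (fill3 5 (succE widthE) dimE dimE 7 (.lit 0) (rowE (var 5) (var 6)) (var 7)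
    (columnE (succE (var 5)) (var 6) (var 7)))
  (fill2 5 dimE dimE 9 (.lit 0) (var 5) (var 6) (.get 6 (.lit 0) (var 5) (var 6))))

/-- `1` if `i = j` and `0` otherwise. -/
def deltaE (i j : IExp) : RExp := .iteLt i j (.lit 0) (.iteLt j i (.lit 0) (.lit 1))

/-- Inversion of a matrix, stored in the array `arr` with first index `i`. -/
def sweepCom (arr : ℕ) : Com :=
  .loop 6 dimE (fill2 7 dimE dimE arr (var 5) (rowE (succE (var 6)) (var 7)) (var 8)
    (.sub (.get arr (var 5) (rowE (var 6) (var 7)) (var 8))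
      (.div (.mul
        (.add (.get arr (var 5) (rowE (var 6) (var 7)) (var 6)) (deltaE (var 7) (var 6)))
        (.sub (.get arr (var 5) (rowE (var 6) (var 6)) (var 8)) (deltaE (var 8) (var 6))))
      (.get arr (var 5) (rowE (var 6) (var 6)) (var 6)))))

/-- The first generator of the next step. -/
def nextACom : Com :=
  fill3 6 (succE widthE) dimE dimE 6 (succE (var 5)) (rowE (var 6) (var 7)) (var 8)
    (.sub (.get 6 (var 5) (rowE (var 6) (var 7)) (var 8))
      (.sum 9 dimE (.mul (.get 7 (var 5) (rowE (var 6) (var 7)) (var 9))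
        (.get 10 (var 5) (var 9) (var 8)))))

/-- The second generator of the next step. -/
def nextBCom : Com :=
  fill3 6 (succE widthE) dimE dimE 7 (succE (var 5)) (rowE (var 6) (var 7)) (var 8)
    (.iteLt (var 6) widthE (.sub (.get 7 (var 5) (rowE (succE (var 6)) (var 7)) (var 8))
      (.sum 9 dimE (.mul (.get 6 (var 5) (rowE (succE (var 6)) (var 7)) (var 9))
        (.get 11 (var 5) (var 9) (var 8))))) (.lit 0))

/-- The pivot of the next step. -/
def nextQCom : Com :=
  fill2 6 dimE dimE 9 (succE (var 5)) (var 6) (var 7)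
    (.sub (.get 9 (var 5) (var 6) (var 7))
      (.sum 9 dimE (.mul (.get 7 (var 5) (var 9) (var 6)) (.get 11 (var 5) (var 9) (var 7)))))

/-- One step of the Schur algorithm. -/
def schurStepCom : Com :=
  .seq (fill2 6 dimE dimE 8 (var 5) (var 6) (var 7) (.get 6 (var 5) (var 6) (var 7)))
  (.seq (sweepCom 8)
  (.seq (sweepCom 9)
  (.seq (fill2 6 dimE dimE 10 (var 5) (var 6) (var 7)
    (.sum 9 dimE (.mul (.get 9 (var 5) (rowE dimE (var 6)) (var 9))
      (.get 7 (var 5) (var 7) (var 9)))))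
  (.seq (fill2 6 dimE dimE 11 (var 5) (var 6) (var 7)
    (.sum 9 dimE (.mul (.get 8 (var 5) (rowE dimE (var 6)) (var 9))
      (.get 7 (var 5) (var 9) (var 7)))))
  (.seq nextACom (.seq nextBCom nextQCom))))))

/-- The Schur algorithm. -/
def schurCom : Com := .loop 5 colsE schurStepCom

/-- Forward substitution. -/
def forwardCom : Com :=
  .loop 5 colsE (.seq
    (.loop 6 dimE (.assignReal 12 (var 5) (var 6) (.lit 0)
      (.sub (.get 5 (var 5) (var 6) (.lit 0))
        (.sum 9 (minE widthE (var 5)) (.sum 10 dimE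
          (.mul (.get 6 (.sub (.sub (var 5) (.lit 1)) (var 9)) (rowE (succE (var 9)) (var 6))
            (var 10)) (.get 13 (.sub (.sub (var 5) (.lit 1)) (var 9)) (var 10) (.lit 0))))))))
    (.loop 6 dimE (.assignReal 13 (var 5) (var 6) (.lit 0)
      (.sum 9 dimE (.mul (.get 8 (var 5) (rowE dimE (var 6)) (var 9))
        (.get 12 (var 5) (var 9) (.lit 0)))))))

/-- The index counted from the end. -/
abbrev revE (i : IExp) : IExp := .sub (.sub colsE (.lit 1)) i

/-- Backward substitution. -/
def backwardCom : Com :=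
  .loop 5 colsE (.seq
    (.loop 6 dimE (.assignReal 14 (revE (var 5)) (var 6) (.lit 0)
      (.sub (.get 12 (revE (var 5)) (var 6) (.lit 0))
        (.sum 9 (minE widthE (var 5)) (.sum 10 dimE
          (.mul (.get 6 (revE (var 5)) (rowE (succE (var 9)) (var 10)) (var 6))
            (.get 15 (revE (.sub (.sub (var 5) (.lit 1)) (var 9))) (var 10) (.lit 0))))))))
    (.loop 6 dimE (.assignReal 15 (revE (var 5)) (var 6) (.lit 0)
      (.sum 9 dimE (.mul (.get 8 (revE (var 5)) (rowE dimE (var 6)) (var 9))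
        (.get 14 (revE (var 5)) (var 9) (.lit 0)))))))

/-- The value of the cost function. -/
def costCom : Com :=
  .assignReal 3 (.lit 0) (.lit 0) (.lit 0)
    (.sum 9 colsE (.sum 10 dimE
      (.mul (.get 5 (var 9) (var 10) (.lit 0)) (.get 15 (var 9) (var 10) (.lit 0)))))

/-- The optimal correction. -/
def correctedCom : Com :=
  fill2 5 blocksE (.sub (.add (.get 3 (var 5)) colsE) (.lit 1)) 16 (var 5) (var 6) (.lit 0)
    (.sub (.get 0 (var 5) (var 6) (.lit 0)) (.mul (.get 1 (var 5) (.lit 0) (.lit 0))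
      (.sum 9 dimE (.sum 10
        (.sub (minE colsE (succE (var 6))) (.sub (succE (var 6)) (.get 3 (var 5))))
        (.mul (.get 15 (.add (.sub (succE (var 6)) (.get 3 (var 5))) (var 10)) (var 9) (.lit 0))
          (.get 2 (var 9) (var 5)
            (.sub (var 6) (.add (.sub (succE (var 6)) (.get 3 (var 5))) (var 10)))))))))

/-- The gradient of the cost function. -/
def gradientCom : Com :=
  fill3 5 blocksE (.get 3 (var 5)) dimE 4 (var 7) (var 5) (var 6)
    (.mul (.lit 2) (.sum 9 colsE (.mul (.get 15 (var 9) (var 7) (.lit 0))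
      (.get 16 (var 5) (.add (var 6) (var 9)) (.lit 0)))))

/-- Evaluation of the cost function and of its gradient. -/
def program : Com :=
  .seq rowsCom (.seq rhsCom (.seq initCom (.seq schurCom (.seq forwardCom (.seq backwardCom
    (.seq costCom (.seq correctedCom gradientCom)))))))

end HankelProgram

end

/-! ### Verified execution: right-hand side, initial generators, pivot sweeps -/

noncomputable section

namespace HankelProgram

open ProblemData Matrix

variable {D : ProblemData} {d : ℕ} [NeZero d] {σ : Store}

/-- The sizes and the input are in memory. -/
structure Env (D : ProblemData) (d : ℕ) (σ : Store) : Prop where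
  dim : σ.int 0 0 = d
  cols : σ.int 1 0 = D.n
  blocks : σ.int 2 0 = D.q
  sizes : ∀ k, σ.int 3 k = D.m k
  rows : σ.int 4 0 = D.rows
  data : ∀ i j k, σ.real 0 i j k = D.p i j k
  weight : ∀ i j k, σ.real 1 i j k = D.w i j k
  matrix : ∀ i j k, σ.real 2 i j k = D.R i j k

theorem Env.ext {x : ℕ} {σ' : Store} (h : Env D d σ) (e : σ.Ext (D.table d) x σ') (hx : 5 ≤ x) :
    Env D d σ' where
  dim := by rw [e.int 0 (by omega), h.dim]
  cols := by rw [e.int 1 (by omega), h.cols]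
  blocks := by rw [e.int 2 (by omega), h.blocks]
  sizes k := by rw [e.int 3 (by omega), h.sizes]
  rows := by rw [e.int 4 (by omega), h.rows]
  data i j k := e.ok (a := 0) (h.data i j k)
  weight i j k := e.ok (a := 1) (h.weight i j k)
  matrix i j k := e.ok (a := 2) (h.matrix i j k)

omit [NeZero d] in
theorem Env.width (h : Env D d σ) : σ.int 4 0 - (σ.int 4 0 - σ.int 1 0) = D.width := by
  rw [h.rows, h.cols, ProblemData.width]

/-- The entries of a `d × d` block are correct. -/
def BlockOk (D : ProblemData) (d : ℕ) [NeZero d] (arr i δ : ℕ) (σ : Store) : Prop :=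
  ∀ a b : Fin d, σ.real arr i (δ * d + a) b = D.table d arr i (δ * d + a) b

/-- The entries of a vector are correct. -/
def VecOk (D : ProblemData) (d : ℕ) [NeZero d] (arr i : ℕ) (σ : Store) : Prop :=
  ∀ a : Fin d, σ.real arr i a 0 = D.table d arr i a 0

theorem BlockOk.persistent (arr i δ : ℕ) :
    Persistent (D.table d) (BlockOk D d arr i δ) := fun _ _ e h a b => e.ok (h a b)

theorem VecOk.persistent (arr i : ℕ) :
    Persistent (D.table d) (VecOk D d arr i) := fun _ _ e h a => e.ok (h a)

theorem BlockOk.zero {arr i : ℕ} (h : BlockOk D d arr i 0 σ) (a b : Fin d) :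
    σ.real arr i a b = D.table d arr i a b := by
  simpa using h a b

theorem blockOk_zero {arr i : ℕ} (h : ∀ a < d, ∀ b < d, σ.real arr i a b = D.table d arr i a b) :
    BlockOk D d arr i 0 σ := fun a b => by simpa using h a a.2 b b.2

theorem rhsCom_computes (h : Env D d σ) (hq : D.q ≤ D.rows) :
    Computes (D.table d) 5 rhsCom σ (∑ _r ∈ Finset.range D.n, (d * (3 * D.rows + 2) + 1))
      (fun σ' => ∀ j < D.n, VecOk D d 5 j σ') := by
  refine (Computes.fill2 (J := fun _ => d) (N := fun _ => 3 * D.rows)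
    (u := fun r _ => r) (v := fun _ s => s) (w := fun _ _ => 0) (by exact h.cols)
    (fun r _ σ' e _ => by exact (h.ext e le_rfl).dim) fun r hr s hs σ' e h5 h6 => ?_).weaken le_rfl
    fun σ' _ H j hj a => H j hj a a.2
  have h' := h.ext e le_rfl
  lift s to Fin d using hs
  constructor <;> simp [IExp.eval, RExp.eval, RExp.Defined, RExp.ops, Store.setInt, h5, h6,
    h'.blocks, h'.sizes, h'.matrix, h'.data, table, rhs, residue_val]
  simp only [Finset.sum_add_distrib, ← Finset.sum_mul]
  simp only [Finset.sum_const, Finset.card_range, smul_eq_mul]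
  rw [← ProblemData.rows]
  omega

-- The two alternatives for `δ` serve the two generators, which start from T_δ and T_{δ+1}.
omit [NeZero d] in
theorem columnE_spec (h : Env D d σ) (hq : D.q ≤ D.rows) {δ : IExp} {c r : ℕ} {a b : Fin d}
    (h5 : σ.int 5 0 = r) (h6 : σ.int 6 0 = a) (h7 : σ.int 7 0 = b)
    (hδ : δ = var 5 ∧ c = r ∨ δ = succE (var 5) ∧ c = r + 1) :
    (columnE δ (var 6) (var 7)).Defined σ ∧
      (columnE δ (var 6) (var 7)).ops σ ≤ 6 * D.rows + 1 ∧
      (columnE δ (var 6) (var 7)).eval σ = D.column d c a b := by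
  have hc : ∑ k ∈ Finset.range D.q, ((D.m k - c) * 2 + 1 + 1) ≤ 6 * D.rows := by
    calc _ ≤ ∑ k ∈ Finset.range D.q, (D.m k * 2 + 2) := Finset.sum_le_sum fun k _ => by omega
      _ = D.rows * 2 + D.q * 2 := by
          rw [Finset.sum_add_distrib, ← Finset.sum_mul]; simp [ProblemData.rows]
      _ ≤ _ := by omega
  refine ⟨by simp [columnE, RExp.Defined], ?_, ?_⟩
  · rcases hδ with ⟨rfl, rfl⟩ | ⟨rfl, rfl⟩ <;>
    · simp only [columnE, RExp.ops]
      split_ifs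
      · simpa [IExp.eval, Store.setInt, h5, h.blocks, h.sizes] using hc
      · simp
  · rcases hδ with ⟨rfl, rfl⟩ | ⟨rfl, rfl⟩ <;>
      simp [columnE, RExp.eval, IExp.eval, Store.setInt, h5, h6, h7, h.cols, h.blocks, h.sizes,
        h.matrix, h.weight, column]

theorem initCom_computes (h : Env D d σ) (hq : D.q ≤ D.rows) :
    Computes (D.table d) 5 initCom σ
      (∑ _r ∈ Finset.range (D.width + 1), (d * (d * (6 * D.rows + 1 + 2) + 1) + 1) +
        (∑ _r ∈ Finset.range (D.width + 1), (d * (d * (6 * D.rows + 1 + 2) + 1) + 1) +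
          ∑ _r ∈ Finset.range d, (d * (0 + 2) + 1)))
      (fun σ' => (∀ δ < D.width + 1, BlockOk D d 6 0 δ σ') ∧
        (∀ δ < D.width + 1, BlockOk D d 7 0 δ σ') ∧ BlockOk D d 9 0 0 σ') := by
  refine Computes.seq_and (fun σ₁ σ₂ e H δ hδ => (BlockOk.persistent _ _ _).ext e (H δ hδ))
    ((Computes.fill3 (J := fun _ => d) (K := fun _ => d) (N := fun _ => 6 * D.rows + 1)
    (u := fun _ _ _ => 0) (v := fun r s _ => r * d + s) (w := fun _ _ t => t) ?_
    (fun r _ σ' e _ => by exact (h.ext e le_rfl).dim)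
    (fun r _ σ' e _ => by exact (h.ext e le_rfl).dim)
    fun r hr s hs t ht σ' e h5 h6 h7 => ?_).weaken le_rfl
    fun σ' _ H δ hδ a b => H δ hδ a a.2 b b.2)
    fun σ₁ e₁ H₁ => Computes.seq_and
      (fun σ₁ σ₂ e H δ hδ => (BlockOk.persistent _ _ _).ext e (H δ hδ))
    ((Computes.fill3 (J := fun _ => d) (K := fun _ => d) (N := fun _ => 6 * D.rows + 1)
    (u := fun _ _ _ => 0) (v := fun r s _ => r * d + s) (w := fun _ _ t => t) ?_
    (fun r _ σ' e _ => by exact ((h.ext e₁ le_rfl).ext e le_rfl).dim)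
    (fun r _ σ' e _ => by exact ((h.ext e₁ le_rfl).ext e le_rfl).dim)
    fun r hr s hs t ht σ' e h5 h6 h7 => ?_).weaken le_rfl
    fun σ' _ H δ hδ a b => H δ hδ a a.2 b b.2) fun σ₂ e₂ H₂ =>
    (Computes.fill2 (J := fun _ => d) (N := fun _ => 0)
    (u := fun _ _ => 0) (v := fun r _ => r) (w := fun _ s => s)
    (by exact ((h.ext e₁ le_rfl).ext e₂ le_rfl).dim)
    (fun r _ σ' e _ => by exact (((h.ext e₁ le_rfl).ext e₂ le_rfl).ext e le_rfl).dim)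
    fun r hr s hs σ' e h5 h6 => ?_).weaken le_rfl
    fun σ' _ H => blockOk_zero H
  · simp [IExp.eval, h.width]
  · have h' := h.ext e le_rfl
    lift s to Fin d using hs
    lift t to Fin d using ht
    obtain ⟨g1, g2, g3⟩ := columnE_spec h' hq h5 h6 h7 (.inl ⟨rfl, rfl⟩)
    refine ⟨rfl, by simp [IExp.eval, h5, h6, h'.dim], by simp [IExp.eval, h7], g1, g2, ?_⟩
    rw [g3]
    simp [table, mul_add_div, residue_mul_add, residue_val, genA, schurA, schurState]
  · simp [IExp.eval, (h.ext e₁ le_rfl).width]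
  · have h' := (h.ext e₁ le_rfl).ext e le_rfl
    lift s to Fin d using hs
    lift t to Fin d using ht
    obtain ⟨g1, g2, g3⟩ := columnE_spec h' hq h5 h6 h7 (.inr ⟨rfl, rfl⟩)
    refine ⟨rfl, by simp [IExp.eval, h5, h6, h'.dim], by simp [IExp.eval, h7], g1, g2, ?_⟩
    rw [g3]
    simp [table, mul_add_div, residue_mul_add, residue_val, genB, schurB, schurState]
  · lift r to Fin d using hr
    lift s to Fin d using hs
    have h0 := BlockOk.zero ((BlockOk.persistent _ _ _).ext (e₂.trans e) (H₁ 0 (by omega)))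
    constructor <;> simp [IExp.eval, RExp.eval, RExp.Defined, RExp.ops, h5, h6, h0]
    simp [table, val_div, residue_val, sweep, genA, pivQ, schurA, schurQ, schurState]

theorem deltaE_eval (i j : IExp) (σ : Store) :
    (deltaE i j).eval σ = if i.eval σ = j.eval σ then 1 else 0 := by
  rcases lt_trichotomy (i.eval σ) (j.eval σ) with h | h | h
  · simp [deltaE, RExp.eval, h, h.ne]
  · simp [deltaE, RExp.eval, h]
  · simp [deltaE, RExp.eval, h, h.ne']

theorem deltaE_defined (i j : IExp) (σ : Store) : (deltaE i j).Defined σ := by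
  simp [deltaE, RExp.Defined]

theorem deltaE_ops (i j : IExp) (σ : Store) : (deltaE i j).ops σ ≤ 2 := by
  simp only [deltaE, RExp.ops]
  split_ifs <;> omega

/-- Pass κ reads block κ and writes block κ + 1, so nothing needed is overwritten. The division is
defined by `sweep_pivot_pos`. -/
theorem sweepCom_computes (h : Env D d σ) {arr i : ℕ} {P : Matrix (Fin d) (Fin d) ℝ}
    (hP : P.PosDef) (h5 : σ.int 5 0 = i)
    (ht : ∀ j k, D.table d arr i j k = sweep P (j / d) (residue d j) (residue d k))
    (h0 : BlockOk D d arr i 0 σ) :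
    Computes (D.table d) 6 (sweepCom arr) σ
      (∑ _κ ∈ Finset.range d, (∑ _r ∈ Finset.range d, (d * (9 + 2) + 1) + 1))
      (BlockOk D d arr i d) := by
  refine (Computes.loop (N := fun _ => ∑ _r ∈ Finset.range d, (d * (9 + 2) + 1)) (by exact h.dim)
    (Q := fun κ => BlockOk D d arr i (κ + 1)) (fun κ => BlockOk.persistent _ _ _)
    fun κ hκ σ₁ e₁ h6 H => ?_).weaken le_rfl fun σ' e H => ?_
  · have hB : BlockOk D d arr i κ σ₁ := by
      rcases κ with _ | κ
      · exact (BlockOk.persistent _ _ _).ext e₁ h0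
      · exact H κ (by omega)
    have h1 := h.ext e₁ (by norm_num)
    refine (Computes.fill2 (J := fun _ => d) (N := fun _ => 9)
      (u := fun _ _ => i) (v := fun r _ => (κ + 1) * d + r) (w := fun _ s => s)
      (by exact h1.dim) (fun r _ σ' e _ => by exact (h1.ext e (by norm_num)).dim)
      fun r hr s hs σ' e h7 h8 => ?_).weaken le_rfl fun σ' _ H a b => H a a.2 b b.2
    lift r to Fin d using hr
    lift s to Fin d using hs
    obtain ⟨κ, rfl⟩ : ∃ k : Fin d, k.1 = κ := ⟨⟨κ, hκ⟩, rfl⟩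
    have h' := h1.ext e (by norm_num)
    have h5' : σ'.int 5 0 = i := by rw [e.int 5 (by omega), e₁.int 5 (by omega), h5]
    have h6' : σ'.int 6 0 = κ := by rw [e.int 6 (by omega), h6]
    have hB' : ∀ a b : Fin d, σ'.real arr i (κ * d + a) b = sweep P κ a b := fun a b => by
      rw [(BlockOk.persistent _ _ _).ext e hB a b, ht, mul_add_div, residue_mul_add, residue_val]
    have hpos := sweep_pivot_pos hP κ
    have o1 := deltaE_ops (var 7) (var 6) σ'
    have o2 := deltaE_ops (var 8) (var 6) σ'
    constructor
    · simp [IExp.eval, h5']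
    · simp [IExp.eval, h6', h7, h'.dim]
    · simp [IExp.eval, h8]
    · simp [RExp.Defined, RExp.eval, deltaE_defined, IExp.eval, h5', h6', h'.dim, hB', hpos.ne']
    · simp only [RExp.ops]; omega
    · simp only [RExp.eval, deltaE_eval, IExp.eval, h5', h6', h7, h8, h'.dim, hB', ht,
        residue_mul_add, residue_val, mul_add_div, ofNat_val, sweep, pivotStep, of_apply, Fin.ext_iff]
  · have := H (d - 1) (Nat.sub_lt (NeZero.pos d) one_pos)
    rwa [show d - 1 + 1 = d from Nat.sub_add_cancel (NeZero.pos d)] at this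

end HankelProgram

end

/-! ### Verified execution: the Schur recursion -/

noncomputable section

namespace HankelProgram

open ProblemData Matrix

variable {D : ProblemData} {d : ℕ} [NeZero d] {σ : Store}

theorem BlockOk.ext {arr i δ x : ℕ} {σ' : Store} (h : BlockOk D d arr i δ σ)
    (e : σ.Ext (D.table d) x σ') : BlockOk D d arr i δ σ' :=
  (BlockOk.persistent _ _ _).ext e h

theorem VecOk.ext {arr i x : ℕ} {σ' : Store} (h : VecOk D d arr i σ)
    (e : σ.Ext (D.table d) x σ') : VecOk D d arr i σ' :=
  (VecOk.persistent _ _).ext e h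

theorem fillVec (h : Env D d σ) {x : ℕ} (hx : 5 ≤ x) {arr u N : ℕ} {i : IExp} {e : RExp}
    (H : ∀ (a : Fin d) (σ' : Store), σ.Ext (D.table d) x σ' → Env D d σ' → σ'.int x 0 = a →
      CellSpec (D.table d) σ' N arr i (var x) (.lit 0) e u a 0) :
    Computes (D.table d) x (.loop x dimE (.assignReal arr i (var x) (.lit 0) e)) σ (d * (N + 2))
      (VecOk D d arr u) := by
  refine (Computes.loop (N := fun _ => N + 1) (B := d)
    (Q := fun a σ' => σ'.real arr u a 0 = D.table d arr u a 0) (by exact h.dim)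
    (fun a σ₁ σ₂ e h => e.ok h) fun a ha σ' e _ _ => ?_).weaken (by simp) fun σ' _ H a => H a a.2
  lift a to Fin d using ha
  obtain ⟨p1, p2, p3, p4, p5, p6⟩ := H a σ' e (h.ext e hx) (by assumption)
  exact Computes.assignReal p1 p2 p3 p4 p5 p6

theorem fillBlock (h : Env D d σ) {x : ℕ} (hx : 5 ≤ x) {arr u N : ℕ} {i : IExp} {e : RExp}
    (H : ∀ (a b : Fin d) (σ' : Store), σ.Ext (D.table d) x σ' → Env D d σ' →
      σ'.int x 0 = a → σ'.int (x + 1) 0 = b →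
      CellSpec (D.table d) σ' N arr i (var x) (var (x + 1)) e u a b) :
    Computes (D.table d) x (fill2 x dimE dimE arr i (var x) (var (x + 1)) e) σ
      (d * (d * (N + 2) + 1)) (BlockOk D d arr u 0) := by
  refine (Computes.fill2 (J := fun _ => d) (N := fun _ => N)
    (u := fun _ _ => u) (v := fun r _ => r) (w := fun _ s => s) (by exact h.dim)
    (fun r _ σ' e _ => by exact (h.ext e hx).dim) fun r hr s hs σ' e h5 h6 => ?_).weaken
    (by simp) fun σ' _ H => blockOk_zero H
  lift r to Fin d using hr
  lift s to Fin d using hs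
  exact H r s σ' e (h.ext e hx) h5 h6

theorem fillBlocks (h : Env D d σ) {x : ℕ} (hx : 5 ≤ x) {arr u N : ℕ} {i : IExp} {e : RExp}
    (H : ∀ δ < D.width + 1, ∀ (a b : Fin d) (σ' : Store), σ.Ext (D.table d) x σ' → Env D d σ' →
      σ'.int x 0 = δ → σ'.int (x + 1) 0 = a → σ'.int (x + 2) 0 = b →
      CellSpec (D.table d) σ' N arr i (rowE (var x) (var (x + 1))) (var (x + 2)) e
        u (δ * d + a) b) :
    Computes (D.table d) x
      (fill3 x (succE widthE) dimE dimE arr i (rowE (var x) (var (x + 1))) (var (x + 2)) e) σ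
      ((D.width + 1) * (d * (d * (N + 2) + 1) + 1))
      (fun σ' => ∀ δ < D.width + 1, BlockOk D d arr u δ σ') := by
  refine (Computes.fill3 (I := D.width + 1) (J := fun _ => d) (K := fun _ => d) (N := fun _ => N)
    (u := fun _ _ _ => u) (v := fun r s _ => r * d + s) (w := fun _ _ t => t)
    (by simp [IExp.eval, h.width])
    (fun r _ σ' e _ => by exact (h.ext e hx).dim) (fun r _ σ' e _ => by exact (h.ext e hx).dim)
    fun r hr s hs t ht σ' e h5 h6 h7 => ?_).weaken (by simp)
    fun σ' _ H δ hδ a b => H δ hδ a a.2 b b.2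
  lift s to Fin d using hs
  lift t to Fin d using ht
  exact H r hr s t σ' e (h.ext e hx) h5 h6 h7

theorem copyPivot_computes (h : Env D d σ) {i : ℕ} (h5 : σ.int 5 0 = i)
    (hA : BlockOk D d 6 i 0 σ) :
    Computes (D.table d) 6
      (fill2 6 dimE dimE 8 (var 5) (var 6) (var 7) (.get 6 (var 5) (var 6) (var 7))) σ
      (d * (d * (0 + 2) + 1)) (BlockOk D d 8 i 0) := by
  refine fillBlock h (by norm_num) fun a b σ' e h' h6 h7 => ?_
  have h5' : σ'.int 5 0 = i := by rw [e.int 5 (by norm_num), h5]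
  have hA' := (hA.ext e).zero
  constructor <;> simp [IExp.eval, RExp.eval, RExp.Defined, RExp.ops, h5', h6, h7, hA']
  simp [table, val_div, residue_val, sweep]

theorem prodQ_computes (h : Env D d σ) {i : ℕ} (h5 : σ.int 5 0 = i)
    (hQ : BlockOk D d 9 i d σ) (hB : BlockOk D d 7 i 0 σ) (hp : (D.pivQ d i).PosDef) :
    Computes (D.table d) 6
      (fill2 6 dimE dimE 10 (var 5) (var 6) (var 7)
        (.sum 9 dimE (.mul (.get 9 (var 5) (rowE dimE (var 6)) (var 9))
          (.get 7 (var 5) (var 7) (var 9))))) σ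
      (d * (d * (2 * d + 2) + 1)) (BlockOk D d 10 i 0) := by
  refine fillBlock h (by norm_num) fun a b σ' e h' h6 h7 => ?_
  have h5' : σ'.int 5 0 = i := by rw [e.int 5 (by norm_num), h5]
  have hB' := (hB.ext e).zero
  have hQ' := hQ.ext e
  unfold BlockOk at hQ'
  constructor <;> simp [IExp.eval, RExp.eval, RExp.Defined, RExp.ops, Store.setInt, h5', h6, h7,
    h'.dim, mul_comm d 2]
  rw [Finset.sum_range]
  simp [hB', hQ', table, mul_add_div, residue_mul_add, residue_val, val_div, sweep_eq_inv hp,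
    mul_apply]

theorem prodP_computes (h : Env D d σ) {i : ℕ} (h5 : σ.int 5 0 = i)
    (hP : BlockOk D d 8 i d σ) (hB : BlockOk D d 7 i 0 σ) (hp : (D.genA d i 0).PosDef) :
    Computes (D.table d) 6
      (fill2 6 dimE dimE 11 (var 5) (var 6) (var 7)
        (.sum 9 dimE (.mul (.get 8 (var 5) (rowE dimE (var 6)) (var 9))
          (.get 7 (var 5) (var 9) (var 7))))) σ
      (d * (d * (2 * d + 2) + 1)) (BlockOk D d 11 i 0) := by
  refine fillBlock h (by norm_num) fun a b σ' e h' h6 h7 => ?_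
  have h5' : σ'.int 5 0 = i := by rw [e.int 5 (by norm_num), h5]
  have hB' := (hB.ext e).zero
  have hP' := hP.ext e
  unfold BlockOk at hP'
  constructor <;> simp [IExp.eval, RExp.eval, RExp.Defined, RExp.ops, Store.setInt, h5', h6, h7,
    h'.dim, mul_comm d 2]
  rw [Finset.sum_range]
  simp [hB', hP', table, mul_add_div, residue_mul_add, residue_val, val_div, sweep_eq_inv hp,
    mul_apply]

theorem nextACom_computes (h : Env D d σ) {i : ℕ} (h5 : σ.int 5 0 = i)
    (hA : ∀ δ < D.width + 1, BlockOk D d 6 i δ σ) (hB : ∀ δ < D.width + 1, BlockOk D d 7 i δ σ)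
    (hX : BlockOk D d 10 i 0 σ) :
    Computes (D.table d) 6 nextACom σ
      ((D.width + 1) * (d * (d * (2 * d + 1 + 2) + 1) + 1))
      (fun σ' => ∀ δ < D.width + 1, BlockOk D d 6 (i + 1) δ σ') := by
  refine fillBlocks h (by norm_num) fun δ hδ a b σ' e h' h6 h7 h8 => ?_
  have h5' : σ'.int 5 0 = i := by rw [e.int 5 (by norm_num), h5]
  have hA' := (hA δ hδ).ext e
  have hB' := (hB δ hδ).ext e
  have hX' := (hX.ext e).zero
  unfold BlockOk at hA' hB'
  constructor <;> simp [IExp.eval, RExp.eval, RExp.Defined, RExp.ops, Store.setInt, h5', h6, h7,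
    h8, h'.dim, mul_comm d 2]
  rw [Finset.sum_range]
  simp [hA', hB', hX', table, mul_add_div, residue_mul_add, residue_val, genA, genB,
    pivQ, schurA_succ, mul_apply]

/-- The update reads block δ + 1, which is not stored for the last δ; there the program writes 0,
correct by `schur_band`. -/
theorem nextBCom_computes (h : Env D d σ) {i : ℕ} (h5 : σ.int 5 0 = i)
    (hband : ∀ δ, D.width ≤ δ → D.column d δ = 0)
    (hA : ∀ δ < D.width + 1, BlockOk D d 6 i δ σ) (hB : ∀ δ < D.width + 1, BlockOk D d 7 i δ σ)
    (hX : BlockOk D d 11 i 0 σ) :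
    Computes (D.table d) 6 nextBCom σ
      ((D.width + 1) * (d * (d * (2 * d + 2 + 2) + 1) + 1))
      (fun σ' => ∀ δ < D.width + 1, BlockOk D d 7 (i + 1) δ σ') := by
  refine fillBlocks h (by norm_num) fun δ hδ a b σ' e h' h6 h7 h8 => ?_
  have h5' : σ'.int 5 0 = i := by rw [e.int 5 (by norm_num), h5]
  have hX' := (hX.ext e).zero
  refine ⟨by simp [IExp.eval, h5'], by simp [IExp.eval, h6, h7, h'.dim], by simp [IExp.eval, h8],
    ?_, ?_, ?_⟩
  · simp [RExp.Defined]
  · simp only [RExp.ops]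
    split_ifs <;> simp [IExp.eval, h'.dim, mul_comm d 2]
  · simp only [RExp.eval, IExp.eval, h'.width, h6]
    split_ifs with hlt
    · have hA' := (hA (δ + 1) (by omega)).ext e
      have hB' := (hB (δ + 1) (by omega)).ext e
      unfold BlockOk at hA' hB'
      simp only [Store.setInt, h5', h6, h7, h8, h'.dim]
      rw [Finset.sum_range]
      simp [hA', hB', hX', table, mul_add_div, residue_mul_add, residue_val, genA, genB, schurB_succ, mul_apply]
    · simp only [table, mul_add_div, residue_mul_add, residue_val]
      rw [genB, (schur_band hband (i + 1) δ (by omega)).2]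
      simp

theorem nextQCom_computes (h : Env D d σ) {i : ℕ} (h5 : σ.int 5 0 = i)
    (hQ : BlockOk D d 9 i 0 σ) (hB : BlockOk D d 7 i 0 σ) (hX : BlockOk D d 11 i 0 σ) :
    Computes (D.table d) 6 nextQCom σ (d * (d * (2 * d + 1 + 2) + 1))
      (BlockOk D d 9 (i + 1) 0) := by
  refine fillBlock h (by norm_num) fun a b σ' e h' h6 h7 => ?_
  have h5' : σ'.int 5 0 = i := by rw [e.int 5 (by norm_num), h5]
  have hQ' := (hQ.ext e).zero
  have hB' := (hB.ext e).zero
  have hX' := (hX.ext e).zero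
  constructor <;> simp [IExp.eval, RExp.eval, RExp.Defined, RExp.ops, Store.setInt, h5', h6, h7,
    h'.dim, mul_comm d 2]
  rw [Finset.sum_range]
  simp [hQ', hB', hX', table, residue_val, val_div, genA, genB, sweep,
    pivQ, schurQ_succ, mul_apply]

theorem schurStepCom_computes (h : Env D d σ) {i : ℕ} (h5 : σ.int 5 0 = i)
    (hband : ∀ δ, D.width ≤ δ → D.column d δ = 0) (hP : (D.genA d i 0).PosDef)
    (hQp : (D.pivQ d i).PosDef) (hW : D.width ≤ D.rows) (hM : 1 ≤ D.rows)
    (hA : ∀ δ < D.width + 1, BlockOk D d 6 i δ σ) (hB : ∀ δ < D.width + 1, BlockOk D d 7 i δ σ)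
    (hQ : BlockOk D d 9 i 0 σ) :
    Computes (D.table d) 6 schurStepCom σ (100 * (d ^ 3 * D.rows)) (fun σ' =>
      (∀ δ < D.width + 1, BlockOk D d 6 (i + 1) δ σ') ∧
      (∀ δ < D.width + 1, BlockOk D d 7 (i + 1) δ σ') ∧ BlockOk D d 9 (i + 1) 0 σ' ∧
      BlockOk D d 8 i d σ') := by
  have g5 : ∀ {σ'}, σ.Ext (D.table d) 6 σ' → σ'.int 5 0 = i := fun e => by
    rw [e.int 5 (by norm_num), h5]
  have gE : ∀ {σ'}, σ.Ext (D.table d) 6 σ' → Env D d σ' := fun e => h.ext e (by norm_num)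
  have hd : 1 ≤ d := NeZero.pos d
  have d1 : d ≤ d ^ 3 := Nat.le_self_pow (by norm_num) d
  have d2 : d ^ 2 ≤ d ^ 3 := Nat.pow_le_pow_right hd (by norm_num)
  have d3 : d ^ 3 ≤ d ^ 3 * D.rows := Nat.le_mul_of_pos_right _ hM
  have w1 : D.width + 1 ≤ 2 * D.rows := by omega
  have k1 : (D.width + 1) * (d * (d * (2 * d + 1 + 2) + 1) + 1) ≤ 2 * D.rows * (7 * d ^ 3) :=
    Nat.mul_le_mul w1 (by ring_nf; omega)
  have k2 : (D.width + 1) * (d * (d * (2 * d + 2 + 2) + 1) + 1) ≤ 2 * D.rows * (8 * d ^ 3) :=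
    Nat.mul_le_mul w1 (by ring_nf; omega)
  have k3 : ∑ _κ ∈ Finset.range d, (∑ _r ∈ Finset.range d, (d * (9 + 2) + 1) + 1) ≤
      13 * d ^ 3 := by
    simp only [Finset.sum_const, Finset.card_range, smul_eq_mul]
    ring_nf; omega
  have k4 : 2 * D.rows * (7 * d ^ 3) = 14 * (d ^ 3 * D.rows) := by ring
  have k5 : 2 * D.rows * (8 * d ^ 3) = 16 * (d ^ 3 * D.rows) := by ring
  have k6 : d * (d * (0 + 2) + 1) ≤ 3 * d ^ 3 := by ring_nf; omega
  have k7 : d * (d * (2 * d + 2) + 1) ≤ 5 * d ^ 3 := by ring_nf; omega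
  have k8 : d * (d * (2 * d + 1 + 2) + 1) ≤ 6 * d ^ 3 := by ring_nf; omega
  set X := d ^ 3 * D.rows
  -- The factors of `X` are the budget left after each stage: the two inversions take 13 each, the
  -- two auxiliary products 5 each, the generator updates 14 and 16, the last pivot update 6.
  refine Computes.seq_le (72 * X) (copyPivot_computes h h5 (hA 0 (by omega))) (by omega)
    fun σ₁ e₁ H₁ => ?_
  refine Computes.seq_le (59 * X) (sweepCom_computes (gE e₁) hP (g5 e₁) (fun _ _ => rfl) H₁) (by omega)
    fun σ₂ e₂ H₂ => ?_
  have f₂ := e₁.trans e₂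
  refine Computes.seq_le (46 * X) (sweepCom_computes (gE f₂) hQp (g5 f₂) (fun _ _ => rfl) (hQ.ext f₂)) (by omega)
    fun σ₃ e₃ H₃ => ?_
  have f₃ := f₂.trans e₃
  refine Computes.seq_le (41 * X) (prodQ_computes (gE f₃) (g5 f₃) H₃ ((hB 0 (by omega)).ext f₃) hQp) (by omega)
    fun σ₄ e₄ H₄ => ?_
  have f₄ := f₃.trans e₄
  refine Computes.seq_le (36 * X) (prodP_computes (gE f₄) (g5 f₄) (H₂.ext (e₃.trans e₄))
    ((hB 0 (by omega)).ext f₄) hP) (by omega)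
    fun σ₅ e₅ H₅ => ?_
  have f₅ := f₄.trans e₅
  refine Computes.seq_le (22 * X) (nextACom_computes (gE f₅) (g5 f₅) (fun δ hδ => (hA δ hδ).ext f₅)
    (fun δ hδ => (hB δ hδ).ext f₅) (H₄.ext e₅)) (by omega)
    fun σ₆ e₆ H₆ => ?_
  have f₆ := f₅.trans e₆
  refine Computes.seq_le (6 * X) (nextBCom_computes (gE f₆) (g5 f₆) hband (fun δ hδ => (hA δ hδ).ext f₆)
    (fun δ hδ => (hB δ hδ).ext f₆) (H₅.ext e₆)) (by omega)
    fun σ₇ e₇ H₇ => ?_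
  have f₇ := f₆.trans e₇
  refine Computes.weaken (nextQCom_computes (gE f₇) (g5 f₇) (hQ.ext f₇)
    ((hB 0 (by omega)).ext f₇) (H₅.ext (e₆.trans e₇))) (by omega) fun σ₈ e₈ H₈ => ?_
  exact ⟨fun δ hδ => (H₆ δ hδ).ext (e₇.trans e₈), fun δ hδ => (H₇ δ hδ).ext e₈, H₈,
    H₂.ext (e₃.trans (e₄.trans (e₅.trans (e₆.trans (e₇.trans e₈)))))⟩

theorem schurCom_computes (h : Env D d σ)
    (hband : ∀ δ, D.width ≤ δ → D.column d δ = 0) (hP : ∀ i < D.n, (D.genA d i 0).PosDef)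
    (hQp : ∀ i < D.n, (D.pivQ d i).PosDef) (hW : D.width ≤ D.rows) (hM : 1 ≤ D.rows)
    (hA : ∀ δ < D.width + 1, BlockOk D d 6 0 δ σ) (hB : ∀ δ < D.width + 1, BlockOk D d 7 0 δ σ)
    (hQ : BlockOk D d 9 0 0 σ) :
    Computes (D.table d) 5 schurCom σ (D.n * (100 * (d ^ 3 * D.rows) + 1)) (fun σ' =>
      ∀ i < D.n, (∀ δ < D.width + 1, BlockOk D d 6 i δ σ') ∧ BlockOk D d 8 i d σ') := by
  refine (Computes.loop (N := fun _ => 100 * (d ^ 3 * D.rows)) (B := D.n) (by exact h.cols)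
    (Q := fun i σ' =>
      (∀ δ < D.width + 1, BlockOk D d 6 (i + 1) δ σ') ∧
      (∀ δ < D.width + 1, BlockOk D d 7 (i + 1) δ σ') ∧ BlockOk D d 9 (i + 1) 0 σ' ∧
      BlockOk D d 8 i d σ')
    (fun i σ₁ σ₂ e H => ⟨fun δ hδ => (H.1 δ hδ).ext e, fun δ hδ => (H.2.1 δ hδ).ext e,
      H.2.2.1.ext e, H.2.2.2.ext e⟩) fun i hi σ₁ e₁ h5 H => ?_).weaken (by simp)
      fun σ' e H i hi => ?_
  · have H' : (∀ δ < D.width + 1, BlockOk D d 6 i δ σ₁) ∧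
        (∀ δ < D.width + 1, BlockOk D d 7 i δ σ₁) ∧ BlockOk D d 9 i 0 σ₁ := by
      rcases i with _ | i
      · exact ⟨fun δ hδ => (hA δ hδ).ext e₁, fun δ hδ => (hB δ hδ).ext e₁, hQ.ext e₁⟩
      · obtain ⟨a, b, c, -⟩ := H i (by omega)
        exact ⟨a, b, c⟩
    exact schurStepCom_computes (h.ext e₁ le_rfl) h5 hband (hP i hi) (hQp i hi) hW hM H'.1 H'.2.1
      H'.2.2
  · refine ⟨?_, (H i hi).2.2.2⟩
    rcases i with _ | i
    · exact fun δ hδ => (hA δ hδ).ext e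
    · exact (H i (by omega)).1

end HankelProgram

end

/-! ### Verified execution: substitution, cost, correction, gradient, total count -/

noncomputable section

namespace HankelProgram

open ProblemData Matrix

variable {D : ProblemData} {d : ℕ} [NeZero d] {σ : Store}

theorem bandSolve_eq {ι : Type*} [Fintype ι] (W : ℕ) (N : ℕ → Matrix ι ι ℝ) (g : ℕ → ι → ℝ)
    (L : ℕ → ℕ → Matrix ι ι ℝ) (i : ℕ) : bandSolve W N g L i =
      N i *ᵥ (g i - ∑ t ∈ Finset.range (min W i), L i t *ᵥ bandSolve W N g L (i - 1 - t)) := by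
  rw [bandSolve, Finset.sum_range]

omit [NeZero d] in
theorem forward_eq (i : ℕ) : D.forward d i = (D.genA d i 0)⁻¹ *ᵥ D.residual d i :=
  bandSolve_eq _ _ _ _ _

omit [NeZero d] in
theorem backward_eq (i : ℕ) :
    D.backward d i = (D.genA d (D.n - 1 - i) 0)⁻¹ *ᵥ D.residual' d i :=
  bandSolve_eq _ _ _ _ _

theorem forwardCom_computes (h : Env D d σ) (hP : ∀ i < D.n, (D.genA d i 0).PosDef)
    (hs : ∀ i < D.n, VecOk D d 5 i σ)
    (hA : ∀ i < D.n, (∀ δ < D.width + 1, BlockOk D d 6 i δ σ) ∧ BlockOk D d 8 i d σ) :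
    Computes (D.table d) 5 forwardCom σ
      (D.n * (d * (D.width * (d * 2 + 1) + 1 + 2) + d * (d * 2 + 2) + 1))
      (fun σ' => ∀ i < D.n, VecOk D d 12 i σ' ∧ VecOk D d 13 i σ') := by
  refine (Computes.loop
    (N := fun _ => d * (D.width * (d * 2 + 1) + 1 + 2) + d * (d * 2 + 2)) (B := D.n)
    (by exact h.cols) (Q := fun i σ' => VecOk D d 12 i σ' ∧ VecOk D d 13 i σ')
    (fun i σ₁ σ₂ e H => ⟨H.1.ext e, H.2.ext e⟩) fun i hi σ₁ e₁ h5 H => ?_).weaken (by simp)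
    fun σ' _ H => H
  have h₁ := h.ext e₁ le_rfl
  refine Computes.seq_and (VecOk.persistent _ _) (fillVec h₁ (by norm_num)
    fun a σ' e h' h6 => ?_) fun σ₂ e₂ H₂ => fillVec (h₁.ext e₂ (by norm_num)) (by norm_num)
    fun a σ' e h' h6 => ?_
  · have h5' : σ'.int 5 0 = i := by rw [e.int 5 (by norm_num), h5]
    have hs' := (hs i hi).ext (e₁.trans (e.mono (by norm_num)))
    unfold VecOk at hs'
    refine ⟨by simp [IExp.eval, h5'], by simp [IExp.eval, h6], by simp [IExp.eval], ?_, ?_, ?_⟩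
    · simp [RExp.Defined]
    · simp [RExp.ops, IExp.eval, Store.setInt, h'.dim, h5', h'.width]
    · simp only [RExp.eval, IExp.eval, h'.width, h5', Store.setInt, h'.dim]
      simp only [h6, Nat.reduceEqDiff, false_and, if_false, and_self, if_true, hs',
        table, residue_val, ProblemData.residual, Pi.sub_apply, Finset.sum_apply]
      rw [show D.width - (D.width - i) = min D.width i by omega]
      congr 1
      refine Finset.sum_congr rfl fun t ht => ?_
      rw [Finset.mem_range, lt_min_iff] at ht
      have hA' := ((hA (i - 1 - t) (by omega)).1 (t + 1) (by omega)).ext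
        (e₁.trans (e.mono (by norm_num)))
      have hz := (H (i - 1 - t) (by omega)).2.ext e
      unfold BlockOk at hA'
      unfold VecOk at hz
      rw [Finset.sum_range]
      simp [hA', hz, table, mul_add_div, residue_mul_add, residue_val, mulVec, dotProduct]
  · have h5' : σ'.int 5 0 = i := by rw [(e₂.trans e).int 5 (by norm_num), h5]
    have hP' := (hA i hi).2.ext (e₁.trans ((e₂.trans e).mono (by norm_num)))
    have hr := H₂.ext e
    unfold BlockOk at hP'
    unfold VecOk at hr
    constructor <;> simp [IExp.eval, RExp.eval, RExp.Defined, RExp.ops, Store.setInt, h5', h6,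
      h'.dim]
    rw [Finset.sum_range]
    simp [hP', hr, table, mul_add_div, residue_mul_add, residue_val, forward_eq,
      sweep_eq_inv (hP i hi), mulVec, dotProduct]

/-- The right-hand side is the forward residual, which equals P_i z_i; the middle factor of L D Lᵀ
thus costs nothing extra. -/
theorem backwardCom_computes (h : Env D d σ) (hP : ∀ i < D.n, (D.genA d i 0).PosDef)
    (hA : ∀ i < D.n, (∀ δ < D.width + 1, BlockOk D d 6 i δ σ) ∧ BlockOk D d 8 i d σ)
    (hr : ∀ i < D.n, VecOk D d 12 i σ) :
    Computes (D.table d) 5 backwardCom σ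
      (D.n * (d * (D.width * (d * 2 + 1) + 1 + 2) + d * (d * 2 + 2) + 1))
      (fun σ' => ∀ i < D.n, VecOk D d 15 i σ') := by
  refine (Computes.loop
    (N := fun _ => d * (D.width * (d * 2 + 1) + 1 + 2) + d * (d * 2 + 2)) (B := D.n)
    (by exact h.cols) (Q := fun i σ' => VecOk D d 15 (D.n - 1 - i) σ')
    (fun i σ₁ σ₂ e H => H.ext e) fun i hi σ₁ e₁ h5 H => ?_).weaken (by simp)
    fun σ' _ H i hi => by
      have := H (D.n - 1 - i) (by omega)
      rwa [show D.n - 1 - (D.n - 1 - i) = i by omega] at this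
  have h₁ := h.ext e₁ le_rfl
  have hrev : D.n - 1 - (D.n - 1 - i) = i := by omega
  refine Computes.seq (fillVec (u := D.n - 1 - i) h₁ (by norm_num)
    fun a σ' e h' h6 => ?_) fun σ₂ e₂ H₂ => fillVec (h₁.ext e₂ (by norm_num)) (by norm_num)
    fun a σ' e h' h6 => ?_
  · have h5' : σ'.int 5 0 = i := by rw [e.int 5 (by norm_num), h5]
    have hr' := (hr (D.n - 1 - i) (by omega)).ext (e₁.trans (e.mono (by norm_num)))
    have hA' : ∀ δ < D.width + 1, BlockOk D d 6 (D.n - 1 - i) δ σ' := fun δ hδ =>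
      ((hA (D.n - 1 - i) (by omega)).1 δ hδ).ext (e₁.trans (e.mono (by norm_num)))
    unfold VecOk at hr'
    refine ⟨by simp [IExp.eval, h5', h'.cols], by simp [IExp.eval, h6], by simp [IExp.eval],
      ?_, ?_, ?_⟩
    · simp [RExp.Defined]
    · simp [RExp.ops, IExp.eval, Store.setInt, h'.dim, h5', h'.width]
    · simp only [RExp.eval, IExp.eval, h'.width, h5', Store.setInt, h'.dim]
      simp only [h6, h'.cols, Nat.reduceEqDiff, false_and, if_false, and_self,
        if_true, hr', table, residue_val, residual', Pi.sub_apply, Finset.sum_apply,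
        hrev]
      rw [show D.width - (D.width - i) = min D.width i by omega]
      congr 1
      refine Finset.sum_congr rfl fun t ht => ?_
      rw [Finset.mem_range, lt_min_iff] at ht
      have hA'' := hA' (t + 1) (by omega)
      have hz := (H (i - 1 - t) (by omega)).ext e
      unfold BlockOk at hA''
      unfold VecOk at hz
      rw [Finset.sum_range]
      simp [hA'', hz, table, mul_add_div, residue_mul_add, residue_val, mulVec, dotProduct,
        multiplier, show D.n - 1 - (D.n - 1 - (i - 1 - t)) = i - 1 - t by omega]
  · have h5' : σ'.int 5 0 = i := by rw [(e₂.trans e).int 5 (by norm_num), h5]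
    have hP' := (hA (D.n - 1 - i) (by omega)).2.ext (e₁.trans ((e₂.trans e).mono (by norm_num)))
    have hr := H₂.ext e
    unfold BlockOk at hP'
    unfold VecOk at hr
    constructor <;> simp [IExp.eval, RExp.eval, RExp.Defined, RExp.ops, Store.setInt, h5', h6,
      h'.dim, h'.cols]
    rw [Finset.sum_range]
    simp [hP', hr, table, mul_add_div, residue_mul_add, residue_val, multiplier, hrev,
      backward_eq i, sweep_eq_inv (hP (D.n - 1 - i) (by omega)), mulVec, dotProduct]

theorem costCom_computes (h : Env D d σ) (hs : ∀ i < D.n, VecOk D d 5 i σ)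
    (hy : ∀ i < D.n, VecOk D d 15 i σ) :
    Computes (D.table d) 5 costCom σ (D.n * (d * 2 + 1) + 1)
      (fun σ' => σ'.real 3 0 0 0 = D.cost d) := by
  refine Computes.assignReal (F := D.table d) (u := 0) (v := 0) (w := 0) (by simp [IExp.eval])
    (by simp [IExp.eval]) (by simp [IExp.eval]) ?_ ?_ ?_
  · simp [RExp.Defined]
  · simp [RExp.ops, IExp.eval, Store.setInt, h.cols, h.dim]
  · simp only [RExp.eval, IExp.eval, Store.setInt, h.cols, h.dim, table, cost]
    refine Finset.sum_congr rfl fun j hj => ?_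
    have hs' := hs j (Finset.mem_range.1 hj)
    have hy' := hy j (Finset.mem_range.1 hj)
    unfold VecOk at hs' hy'
    simp
    rw [Finset.sum_range]
    simp [hs', hy', table, residue_val, dotProduct]

theorem correctedCom_computes (h : Env D d σ) (hy : ∀ i < D.n, VecOk D d 15 i σ) :
    Computes (D.table d) 5 correctedCom σ
      (∑ k ∈ Finset.range D.q,
        ((D.m k + D.n - 1) * (d * (min (D.m k) D.n * 2 + 1) + 2 + 2) + 1))
      (fun σ' => ∀ k < D.q, ∀ i < D.m k + D.n - 1, σ'.real 16 k i 0 = D.corrected d k i) := by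
  refine (Computes.fill2 (J := fun k => D.m k + D.n - 1)
    (N := fun k => d * (min (D.m k) D.n * 2 + 1) + 2)
    (u := fun k _ => k) (v := fun _ i => i) (w := fun _ _ => 0) (by exact h.blocks)
    (fun k _ σ' e h5 => by
      have h' := h.ext e le_rfl
      simp [IExp.eval, h5, h'.sizes, h'.cols])
    fun k hk i hi σ' e h5 h6 => ?_).weaken le_rfl fun σ' _ H k hk i hi => H k hk i hi
  have h' := h.ext e le_rfl
  refine ⟨by simp [IExp.eval, h5], by simp [IExp.eval, h6], by simp [IExp.eval], ?_, ?_, ?_⟩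
  · simp [RExp.Defined]
  · simp [RExp.ops, IExp.eval, Store.setInt, h'.dim, h5, h6, h'.cols, h'.sizes]
    refine Nat.mul_le_mul_left _ (Nat.add_le_add_right (Nat.mul_le_mul_right _ ?_) 1)
    omega
  · simp only [RExp.eval, IExp.eval, Store.setInt, h'.dim, table, corrected]
    simp [h5, h6, h'.data, h'.weight, h'.matrix, h'.sizes, h'.cols]
    left
    rw [Finset.sum_range]
    refine Finset.sum_congr rfl fun a _ => Finset.sum_congr rfl fun t ht => ?_
    rw [Finset.mem_range] at ht
    have hy' := (hy (i + 1 - D.m k + t) (by omega)).ext e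
    unfold VecOk at hy'
    simp [hy', table, residue_val]

theorem gradientCom_computes (h : Env D d σ) (hy : ∀ i < D.n, VecOk D d 15 i σ)
    (hc : ∀ k < D.q, ∀ i < D.m k + D.n - 1, σ.real 16 k i 0 = D.corrected d k i) :
    Computes (D.table d) 5 gradientCom σ
      (∑ k ∈ Finset.range D.q, (D.m k * (d * (D.n * 2 + 1 + 2) + 1) + 1))
      (fun σ' => ∀ k < D.q, ∀ r < D.m k, ∀ a : Fin d, σ'.real 4 a k r = D.gradEntry d a k r) := by
  refine (Computes.fill3 (J := fun k => D.m k) (K := fun _ => d) (N := fun _ => D.n * 2 + 1)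
    (u := fun _ _ a => a) (v := fun k _ _ => k) (w := fun _ r _ => r) (by exact h.blocks)
    (fun k _ σ' e h5 => by simp [IExp.eval, h5, (h.ext e le_rfl).sizes])
    (fun k _ σ' e h5 => by exact (h.ext e le_rfl).dim)
    fun k hk r hr a ha σ' e h5 h6 h7 => ?_).weaken le_rfl fun σ' _ H k hk r hr a => by
      simpa [table, residue_val] using H k hk r hr a a.2
  have h' := h.ext e le_rfl
  lift a to Fin d using ha
  refine ⟨by simp [IExp.eval, h7], by simp [IExp.eval, h5], by simp [IExp.eval, h6], ?_, ?_, ?_⟩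
  · simp [RExp.Defined]
  · simp [RExp.ops, IExp.eval, h'.cols]
  · simp only [RExp.eval, IExp.eval, Store.setInt, h'.cols, table, gradEntry, residue_val]
    simp [h5, h6, h7]
    refine Finset.sum_congr rfl fun j hj => ?_
    rw [Finset.mem_range] at hj
    have hy' := (hy j hj).ext e
    have hc' := e.ok (a := 16) (hc k hk (r + j) (by omega))
    unfold VecOk at hy'
    simp [hy', hc', table, residue_val]

omit [NeZero d] in
theorem column_zero_transpose : (D.column d 0)ᵀ = D.column d 0 := by
  ext a b
  simp only [transpose_apply, column, of_apply, add_zero, mul_comm]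

-- For δ ≥ m each inner sum is empty; for δ ≥ n the cutoff in `column` applies, which is harmless
-- because such blocks lie outside the n × n matrix.
omit [NeZero d] in
theorem column_eq_zero (δ : ℕ) (hδ : D.width ≤ δ) : D.column d δ = 0 := by
  ext a b
  simp only [column, of_apply, Matrix.zero_apply, ite_eq_right_iff]
  intro hlt
  refine Finset.sum_eq_zero fun k hk => ?_
  have : D.m k ≤ D.rows := Finset.single_le_sum (fun _ _ => Nat.zero_le _) hk
  rw [width_eq] at hδ
  rw [show D.m k - δ = 0 by omega]
  simp

/-- The input is in memory. -/
structure InputOk (D : ProblemData) (d : ℕ) (σ : Store) : Prop where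
  dim : σ.int 0 0 = d
  cols : σ.int 1 0 = D.n
  blocks : σ.int 2 0 = D.q
  sizes : ∀ k, σ.int 3 k = D.m k
  data : ∀ i j k, σ.real 0 i j k = D.p i j k
  weight : ∀ i j k, σ.real 1 i j k = D.w i j k
  matrix : ∀ i j k, σ.real 2 i j k = D.R i j k

-- The accumulator is an integer cell that is overwritten, and `Store.Ext` does not track such
-- values; the run is therefore constructed explicitly.
omit [NeZero d] in
theorem rowsCom_exec (h : InputOk D d σ) :
    ∃ σ', Exec rowsCom σ σ' (1 + ∑ _t ∈ Finset.range D.q, (1 + 1)) ∧ Env D d σ' := by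
  let step : ℕ → Store → Store := fun t τ =>
    (τ.setInt 5 0 t).setInt 4 0 (τ.int 4 0 + τ.int 3 t)
  let s : ℕ → Store := fun t => Nat.rec (σ.setInt 4 0 0) step t
  have hs : ∀ t, (s t).real = σ.real ∧ (∀ a < 4, (s t).int a = σ.int a) ∧
      (s t).int 4 0 = ∑ k ∈ Finset.range t, D.m k := by
    intro t
    induction t with
    | zero =>
      refine ⟨rfl, fun a ha => ?_, by simp [s, Store.setInt]⟩
      ext i
      simp [s, Store.setInt, ha.ne]
    | succ t ih =>
      obtain ⟨h1, h2, h3⟩ := ih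
      have e : s (t + 1) = step t (s t) := rfl
      refine ⟨by rw [e, ← h1]; rfl, fun a ha => ?_, ?_⟩
      · rw [e, ← h2 a ha]
        ext i
        simp only [step, Store.setInt, ha.ne, false_and, if_false]
        rw [if_neg (by omega)]
      · rw [e, Finset.sum_range_succ, ← h3, ← h.sizes t, ← h2 3 (by norm_num)]
        simp [step, Store.setInt]
  have hb : blocksE.eval (s 0) = D.q := by
    have := (hs 0).2.1 2 (by norm_num)
    rw [← h.blocks, ← this]; rfl
  have hl : Exec (.loop 5 blocksE (.assignInt 4 (.lit 0) (.add (var 4) (.get 3 (var 5)))))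
      (s 0) (s D.q) (∑ _t ∈ Finset.range D.q, (1 + 1)) := by
    have := Exec.loop (x := 5) (b := blocksE)
      (c := .assignInt 4 (.lit 0) (.add (var 4) (.get 3 (var 5)))) s (fun _ => 1) fun t _ => by
        have e := Exec.assignInt 4 (.lit 0) (.add (var 4) (.get 3 (var 5))) ((s t).setInt 5 0 t)
        simp only [IExp.eval] at e
        simpa [Store.setInt, s, step] using e
    rwa [hb] at this
  refine ⟨s D.q, .seq (.assignInt 4 (.lit 0) (.lit 0) σ) hl, ?_⟩
  obtain ⟨h1, h2, h3⟩ := hs D.q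
  exact ⟨by rw [h2 0 (by norm_num), h.dim], by rw [h2 1 (by norm_num), h.cols],
    by rw [h2 2 (by norm_num), h.blocks], fun k => by rw [h2 3 (by norm_num), h.sizes], h3,
    fun i j k => by rw [h1, h.data], fun i j k => by rw [h1, h.weight],
    fun i j k => by rw [h1, h.matrix]⟩

theorem program_exec (h : InputOk D d σ) (hn : 1 ≤ D.n) (hq : 1 ≤ D.q)
    (hm : ∀ k < D.q, 1 ≤ D.m k) (hP : ∀ i < D.n, (D.genA d i 0).PosDef)
    (hQ : ∀ i < D.n, (D.pivQ d i).PosDef) :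
    ∃ σ' N, Exec program σ σ' N ∧ N ≤ 300 * (d ^ 3 * D.rows * D.n) ∧
      σ'.real 3 0 0 0 = D.cost d ∧
      ∀ k < D.q, ∀ r < D.m k, ∀ a : Fin d, σ'.real 4 a k r = D.gradEntry d a k r := by
  have hd : 1 ≤ d := NeZero.pos d
  have hqM : D.q ≤ D.rows := by
    calc D.q = ∑ k ∈ Finset.range D.q, 1 := by simp
      _ ≤ D.rows := Finset.sum_le_sum fun k hk => hm k (Finset.mem_range.1 hk)
  have hM : 1 ≤ D.rows := hq.trans hqM
  have hWM : D.width ≤ D.rows := by rw [width_eq]; exact min_le_left _ _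
  have hWn : D.width ≤ D.n := by rw [width_eq]; exact min_le_right _ _
  have hband : ∀ δ, D.width ≤ δ → D.column d δ = 0 := column_eq_zero
  obtain ⟨σ₀, hx, h₀⟩ := rowsCom_exec h
  set X := d ^ 3 * D.rows * D.n with hX
  have hd1 : d ≤ d ^ 3 := Nat.le_self_pow (by norm_num) d
  have hd2 : d ^ 2 ≤ d ^ 3 := Nat.pow_le_pow_right hd (by norm_num)
  have hd0 : 1 ≤ d ^ 3 := hd.trans hd1
  have b1 : ∑ _r ∈ Finset.range D.n, (d * (3 * D.rows + 2) + 1) ≤ 6 * X := by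
    simp only [Finset.sum_const, Finset.card_range, smul_eq_mul]
    calc D.n * (d * (3 * D.rows + 2) + 1) ≤ D.n * (d ^ 3 * (3 * D.rows + 2 * D.rows) +
          d ^ 3 * D.rows) := by
          gcongr
          · omega
          · exact Nat.mul_pos hd0 hM
      _ = 6 * X := by rw [hX]; ring
  have b2 : ∑ _r ∈ Finset.range (D.width + 1), (d * (d * (6 * D.rows + 1 + 2) + 1) + 1) ≤
      22 * X := by
    simp only [Finset.sum_const, Finset.card_range, smul_eq_mul]
    calc (D.width + 1) * (d * (d * (6 * D.rows + 1 + 2) + 1) + 1)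
        ≤ (2 * D.n) * (11 * d ^ 3 * D.rows) := by
          refine Nat.mul_le_mul (by omega) ?_
          calc d * (d * (6 * D.rows + 1 + 2) + 1) + 1
              = d ^ 2 * (6 * D.rows + 3) + d + 1 := by ring
            _ ≤ d ^ 3 * (9 * D.rows) + d ^ 3 * D.rows + d ^ 3 * D.rows := by
                gcongr
                · omega
                · exact hd1.trans (Nat.le_mul_of_pos_right _ hM)
                · exact Nat.mul_pos hd0 hM
            _ = 11 * d ^ 3 * D.rows := by ring
      _ = 22 * X := by rw [hX]; ring
  have hX1 : d ^ 3 * D.rows ≤ X := Nat.le_mul_of_pos_right _ hn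
  have hX2 : d ^ 3 ≤ d ^ 3 * D.rows := Nat.le_mul_of_pos_right _ hM
  have hX3 : D.rows ≤ d ^ 3 * D.rows := Nat.le_mul_of_pos_left _ hd0
  have b3 : ∑ _r ∈ Finset.range d, (d * (0 + 2) + 1) ≤ 3 * X := by
    simp only [Finset.sum_const, Finset.card_range, smul_eq_mul]
    ring_nf
    omega
  have b4 : D.n * (100 * (d ^ 3 * D.rows) + 1) ≤ 101 * X := by
    calc _ ≤ D.n * (100 * (d ^ 3 * D.rows) + d ^ 3 * D.rows) := by
          gcongr
          exact Nat.mul_pos hd0 hM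
      _ = 101 * X := by rw [hX]; ring
  have b5 : D.n * (d * (D.width * (d * 2 + 1) + 1 + 2) + d * (d * 2 + 2) + 1) ≤ 11 * X := by
    calc _ ≤ D.n * (d ^ 2 * (3 * D.rows + 3) + d ^ 2 * 4 + d ^ 3) := by
          have : D.width * (d * 2 + 1) ≤ D.rows * (3 * d) := Nat.mul_le_mul hWM (by omega)
          have : d * (D.width * (d * 2 + 1) + 1 + 2) ≤ d * (D.rows * (3 * d) + 3 * d) :=
            Nat.mul_le_mul_left _ (by linarith)
          have : d * (d * 2 + 2) ≤ d * (4 * d) := by gcongr; omega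
          refine Nat.mul_le_mul_left _ ?_
          nlinarith
      _ ≤ D.n * (d ^ 3 * (6 * D.rows) + d ^ 3 * (4 * D.rows) + d ^ 3 * D.rows) := by
          gcongr
          · omega
          · omega
      _ = 11 * X := by rw [hX]; ring
  have b6 : D.n * (d * 2 + 1) + 1 ≤ 4 * X := by
    have : D.n * (d * 2 + 1) ≤ D.n * (3 * (d ^ 3 * D.rows)) := by
      gcongr
      omega
    have : D.n * (3 * (d ^ 3 * D.rows)) = 3 * X := by rw [hX]; ring
    omega
  have b7 : ∑ k ∈ Finset.range D.q,
      ((D.m k + D.n - 1) * (d * (min (D.m k) D.n * 2 + 1) + 2 + 2) + 1) ≤ 15 * X := by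
    calc _ ≤ ∑ k ∈ Finset.range D.q, (15 * d ^ 3 * D.n) * D.m k := by
          refine Finset.sum_le_sum fun k hk => ?_
          have hk1 := hm k (Finset.mem_range.1 hk)
          -- The sum is at most twice the maximum, and maximum times minimum is the product. This
          -- keeps the correction of all data within O(dmn).
          have c1 : (D.m k + D.n - 1) * min (D.m k) D.n ≤ 2 * (D.m k * D.n) := by
            rcases le_total (D.m k) D.n with hle | hle
            · rw [min_eq_left hle]
              calc _ ≤ (2 * D.n) * D.m k := Nat.mul_le_mul_right _ (by omega)
                _ = _ := by ring
            · rw [min_eq_right hle]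
              calc _ ≤ (2 * D.m k) * D.n := Nat.mul_le_mul_right _ (by omega)
                _ = _ := by ring
          have c2 : D.m k + D.n - 1 ≤ 2 * (D.m k * D.n) :=
            le_trans (Nat.le_mul_of_pos_right _ (by omega)) c1
          have c3 : 1 ≤ d ^ 3 * (D.m k * D.n) := Nat.mul_pos hd0 (Nat.mul_pos hk1 hn)
          calc (D.m k + D.n - 1) * (d * (min (D.m k) D.n * 2 + 1) + 2 + 2) + 1
              = d * 2 * ((D.m k + D.n - 1) * min (D.m k) D.n) +
                (d + 4) * (D.m k + D.n - 1) + 1 := by ring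
            _ ≤ d ^ 3 * 2 * (2 * (D.m k * D.n)) + (d ^ 3 + 4 * d ^ 3) * (2 * (D.m k * D.n)) +
                d ^ 3 * (D.m k * D.n) := by
                gcongr
                omega
            _ = 15 * d ^ 3 * D.n * D.m k := by ring
      _ = 15 * X := by rw [← Finset.mul_sum, ← ProblemData.rows, hX]; ring
  have b8 : ∑ k ∈ Finset.range D.q, (D.m k * (d * (D.n * 2 + 1 + 2) + 1) + 1) ≤ 7 * X := by
    calc _ ≤ ∑ k ∈ Finset.range D.q, (7 * d ^ 3 * D.n) * D.m k := by
          refine Finset.sum_le_sum fun k hk => ?_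
          have hk1 := hm k (Finset.mem_range.1 hk)
          have c3 : 1 ≤ d ^ 3 * (D.m k * D.n) := Nat.mul_pos hd0 (Nat.mul_pos hk1 hn)
          calc D.m k * (d * (D.n * 2 + 1 + 2) + 1) + 1
              ≤ D.m k * (d ^ 3 * (5 * D.n) + d ^ 3 * D.n) + d ^ 3 * (D.m k * D.n) := by
                gcongr
                · omega
                · exact Nat.mul_pos hd0 hn
            _ = 7 * d ^ 3 * D.n * D.m k := by ring
      _ = 7 * X := by rw [← Finset.mul_sum, ← ProblemData.rows, hX]; ring
  have b0 : 1 + ∑ _t ∈ Finset.range D.q, (1 + 1) ≤ 3 * X := by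
    simp only [Finset.sum_const, Finset.card_range, smul_eq_mul]
    omega
  have main : Computes (D.table d) 5 (.seq rhsCom (.seq initCom (.seq schurCom (.seq forwardCom
      (.seq backwardCom (.seq costCom (.seq correctedCom gradientCom))))))) σ₀ (202 * X)
      fun σ' => σ'.real 3 0 0 0 = D.cost d ∧
        ∀ k < D.q, ∀ r < D.m k, ∀ a : Fin d, σ'.real 4 a k r = D.gradEntry d a k r := by
    have gE : ∀ {σ'}, σ₀.Ext (D.table d) 5 σ' → Env D d σ' := fun e => h₀.ext e le_rfl
    refine Computes.seq_le (196 * X) (rhsCom_computes h₀ hqM) (by omega) fun σ₁ f₁ s₁ => ?_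
    refine Computes.seq_le (149 * X) (initCom_computes (gE f₁) hqM) (by omega)
      fun σ₂ e₂ s₂ => ?_
    have f₂ := f₁.trans e₂
    refine Computes.seq_le (48 * X) (schurCom_computes (gE f₂) hband hP hQ hWM hM s₂.1 s₂.2.1
      s₂.2.2) (by omega) fun σ₃ e₃ s₃ => ?_
    have f₃ := f₂.trans e₃
    have s₁₃ : ∀ j < D.n, VecOk D d 5 j σ₃ := fun j hj => (s₁ j hj).ext (e₂.trans e₃)
    refine Computes.seq_le (37 * X) (forwardCom_computes (gE f₃) hP s₁₃ s₃) (by omega)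
      fun σ₄ e₄ s₄ => ?_
    have f₄ := f₃.trans e₄
    refine Computes.seq_le (26 * X) (backwardCom_computes (gE f₄) hP
      (fun i hi => ⟨fun δ hδ => ((s₃ i hi).1 δ hδ).ext e₄, (s₃ i hi).2.ext e₄⟩)
      fun i hi => (s₄ i hi).1) (by omega) fun σ₅ e₅ s₅ => ?_
    have f₅ := f₄.trans e₅
    refine Computes.weaken (N := D.n * (d * 2 + 1) + 1 + 22 * X) (Computes.seq_and
      (fun τ τ' e hτ => e.ok (a := 3) (i := 0) (j := 0) (k := 0) hτ)
      (costCom_computes (gE f₅) (fun j hj => (s₁₃ j hj).ext (e₄.trans e₅)) s₅)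
      fun σ₆ e₆ s₆ => ?_) (by omega) fun _ _ hτ => hτ
    have f₆ := f₅.trans e₆
    refine Computes.seq_le (7 * X) (correctedCom_computes (gE f₆) fun i hi => (s₅ i hi).ext e₆)
      (by omega) fun σ₇ e₇ s₇ => ?_
    exact Computes.weaken (gradientCom_computes (gE (f₆.trans e₇))
      (fun i hi => (s₅ i hi).ext (e₆.trans e₇)) s₇) b8 fun _ _ hτ => hτ
  obtain ⟨σ', N, g1, g2, -, g3⟩ := main
  exact ⟨σ', _, .seq hx g1, by omega, g3⟩

end HankelProgram

end

/-! ### The computed quantities are those of the Hankel problem -/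

noncomputable section

namespace HankelProgram

open ProblemData Matrix

section Solve

variable {D : ProblemData} {d : ℕ}

/-- The banded substitutions solve the full triangular systems because the omitted blocks vanish;
what remains is reversal of summation indices. -/
theorem multiplier_solves (hT : (D.column d 0)ᵀ = D.column d 0)
    (hband : ∀ δ, D.width ≤ δ → D.column d δ = 0)
    (hpos : BlockPosDef D.n (toeplitzBlock (D.column d))) (r : ℕ) (hr : r < D.n) :
    ∑ c ∈ Finset.range D.n, toeplitzBlock (D.column d) r c *ᵥ D.multiplier d c = D.rhs d r := by
  have hP : ∀ i < D.n, (D.genA d i 0).PosDef := fun i hi => (schur_invariants hT hpos i hi).2.2.2.1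
  have hmul : ∀ i < D.n, ∀ v, D.genA d i 0 *ᵥ ((D.genA d i 0)⁻¹ *ᵥ v) = v := fun i hi v => by
    rw [mulVec_mulVec, mul_nonsing_inv _ ((Matrix.isUnit_iff_isUnit_det _).1 (hP i hi).isUnit),
      one_mulVec]
  have hfw : ∀ i < D.n, D.genA d i 0 *ᵥ D.forward d i = D.residual d i := fun i hi => by
    rw [forward_eq, hmul i hi]
  have hzero : ∀ i t, D.width ≤ t → D.genA d i (t + 1) = 0 := fun i t ht =>
    (schur_band hband i (t + 1) (by omega)).1
  refine toeplitzBlock_solve hT hpos (z := D.forward d) (fun i hi => ?_) (fun i hi => ?_) r hr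
  · rw [Finset.sum_range_succ, Nat.sub_self]
    change _ + D.genA d i 0 *ᵥ D.forward d i = _
    rw [hfw i hi, ProblemData.residual, ← Finset.sum_range_reflect, add_sub_assoc', sub_eq_iff_eq_add,
      add_comm]
    congr 1
    symm
    refine Finset.sum_subset_zero_on_sdiff (Finset.range_mono (min_le_right _ _))
      (fun t ht => ?_) (fun t ht => ?_)
    · simp only [Finset.mem_sdiff, Finset.mem_range, lt_min_iff, not_and, not_lt] at ht
      rw [show i - (i - 1 - t) = t + 1 by omega]
      change D.genA d _ (t + 1) *ᵥ _ = 0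
      rw [hzero _ _ (by omega), zero_mulVec]
    · simp only [Finset.mem_range, lt_min_iff] at ht
      rw [show i - (i - 1 - t) = t + 1 by omega]
      rfl
  · obtain ⟨k, hk⟩ : ∃ k, D.n - i = k + 1 := ⟨D.n - i - 1, by omega⟩
    have hs : (D.genA d i 0)ᵀ = D.genA d i 0 := by
      have := (hP i hi).isHermitian
      rwa [IsHermitian, conjTranspose_eq_transpose_of_trivial] at this
    rw [hk, Finset.sum_range_succ']
    change D.genA d i 0 *ᵥ D.forward d i = _ + (D.genA d i 0)ᵀ *ᵥ D.multiplier d (i + 0)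
    rw [hfw i hi, hs, add_zero, multiplier, backward_eq, show D.n - 1 - (D.n - 1 - i) = i by omega,
      hmul i hi, ProblemData.residual', show D.n - 1 - (D.n - 1 - i) = i by omega,
      show D.n - 1 - i = k by omega, add_sub_assoc', eq_sub_iff_add_eq, add_comm]
    congr 1
    refine Finset.sum_subset_zero_on_sdiff (Finset.range_mono (min_le_right _ _))
      (fun t ht => ?_) (fun t ht => ?_)
    · simp only [Finset.mem_sdiff, Finset.mem_range, lt_min_iff, not_and, not_lt] at ht
      change (D.genA d _ (t + 1))ᵀ *ᵥ _ = 0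
      rw [hzero _ _ (by omega), transpose_zero, zero_mulVec]
    · simp only [Finset.mem_range, lt_min_iff] at ht
      change _ = (D.genA d i (t + 1))ᵀ *ᵥ D.backward d (D.n - 1 - (i + (t + 1)))
      rw [show D.n - 1 - (i + (t + 1)) = k - 1 - t by omega]

end Solve

variable {q : ℕ} {m : Fin q → ℕ} {n d : ℕ} {ω : Fin q → ENNReal} {p : HankelParam m n → ℝ}
  {R : Matrix (Fin d) (HankelRow m) ℝ} {σ : Store}

/-- The problem stored in the memory. -/
def storedData (n q : ℕ) (σ : Store) : ProblemData where
  n := n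
  q := q
  m := σ.int 3
  p := σ.real 0
  w := σ.real 1
  R := σ.real 2

theorem storedData_inputOk (h : HoldsInput ω p R σ) : InputOk (storedData n q σ) d σ :=
  ⟨h.size_d, h.size_n, h.size_q, fun _ => rfl, fun _ _ _ => rfl, fun _ _ _ => rfl,
    fun _ _ _ => rfl⟩

theorem storedData_rows (h : HoldsInput ω p R σ) : (storedData n q σ).rows = ∑ k, m k := by
  rw [ProblemData.rows]
  change ∑ k ∈ Finset.range q, σ.int 3 k = _
  rw [Finset.sum_range]
  exact Finset.sum_congr rfl fun k _ => h.size_m k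

theorem hankelVec_eq_sum (v : HankelParam m n → ℝ) (j : Fin n) (a : Fin d) :
    hankelVec v R (j, a) = ∑ k, ∑ r : Fin (m k), R a ⟨k, r⟩ *
      v ⟨k, ⟨r + j, by have := r.2; have := j.2; omega⟩⟩ := by
  simp only [hankelVec, mul_apply, Fintype.sum_sigma, layeredHankel, of_apply]

theorem rhs_eq (h : HoldsInput ω p R σ) (j : Fin n) (a : Fin d) :
    (storedData n q σ).rhs d j a = hankelVec p R (j, a) := by
  rw [hankelVec_eq_sum, ProblemData.rhs]
  change ∑ k ∈ Finset.range q, ∑ r ∈ Finset.range (σ.int 3 k),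
    σ.real 2 a k r * σ.real 0 k (r + j) 0 = _
  rw [Finset.sum_range]
  refine Finset.sum_congr rfl fun k _ => ?_
  rw [h.size_m, Finset.sum_range]
  refine Finset.sum_congr rfl fun r _ => ?_
  rw [← h.matrix a ⟨k, r⟩, ← h.data]

theorem hankelMap_apply (h : HoldsInput ω p R σ) (j : Fin n) (a : Fin d) (k : Fin q)
    (i : Fin (m k + n - 1)) : hankelMap n R (j, a) ⟨k, i⟩ =
      if j.1 ≤ i.1 ∧ i.1 - j.1 < m k then σ.real 2 a k (i.1 - j.1) else 0 := by
  have e : hankelMap n R (j, a) ⟨k, i⟩ = ∑ r : HankelRow m, R a r *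
      if r.1 = k ∧ r.2.1 + j.1 = i.1 then 1 else 0 := by
    simp only [hankelMap, of_apply, mul_apply, layeredHankel, Pi.single_apply]
    refine Finset.sum_congr rfl fun r _ => ?_
    congr 2
    obtain ⟨k', r⟩ := r
    by_cases hk : k' = k
    · subst hk
      simp [Fin.ext_iff]
    · simp [hk]
  rw [e]
  split_ifs with hc
  · rw [Finset.sum_eq_single ⟨k, ⟨i.1 - j.1, hc.2⟩⟩]
    · rw [if_pos ⟨rfl, by simp only; omega⟩, mul_one, ← h.matrix]
    · rintro ⟨k', r⟩ _ hne
      rw [if_neg, mul_zero]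
      rintro ⟨rfl, h2⟩
      refine hne ?_
      simp only at h2
      congr 1
      ext
      simp only
      omega
    · simp
  · refine Finset.sum_eq_zero fun r _ => ?_
    rw [if_neg, mul_zero]
    rintro ⟨rfl, h2⟩
    have := r.2.2
    omega

/-- Column j of a Hankel block is the data window shifted by j, and the weight is constant along the
block. Pairing two rows of G hence depends on j and j' only through the overlap of two copies of R
at distance j - j'. -/
theorem gram_eq_toeplitz (h : HoldsInput ω p R σ) (j j' : Fin n) (a a' : Fin d) :
    (matG n ω R * (matG n ω R)ᵀ) (j, a) (j', a') =
      toeplitzBlock ((storedData n q σ).column d) j j' a a' := by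
  have key : ∀ (j j' : Fin n) (a a' : Fin d), j'.1 ≤ j.1 →
      (matG n ω R * (matG n ω R)ᵀ) (j, a) (j', a') =
        (storedData n q σ).column d (j.1 - j'.1) a a' := by
    intro j j' a a' hle
    rw [matG_mul_transpose_apply]
    -- A Gram entry is R H(v) for the data v formed by a rescaled row of `hankelMap`, which reduces
    -- it to a sum over the rows of R.
    change (hankelMap n R *ᵥ fun t => (ω t.1)⁻¹.toReal * hankelMap n R (j', a') t) (j, a) = _
    rw [hankelMap_mulVec, hankelVec_eq_sum, column, of_apply, if_pos (by
      change _ < n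
      omega)]
    change _ = ∑ k ∈ Finset.range q, σ.real 1 k 0 0 *
      ∑ r ∈ Finset.range (σ.int 3 k - (j.1 - j'.1)),
        σ.real 2 a k r * σ.real 2 a' k (r + (j.1 - j'.1))
    rw [Finset.sum_range]
    refine Finset.sum_congr rfl fun k _ => ?_
    rw [h.weight, h.size_m, Finset.mul_sum]
    have e : ∀ r ∈ Finset.range (m k - (j.1 - j'.1)),
        (ω k)⁻¹.toReal * (σ.real 2 a k r * σ.real 2 a' k (r + (j.1 - j'.1))) =
          σ.real 2 a k r * ((ω k)⁻¹.toReal * if r + (j.1 - j'.1) < m k then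
            σ.real 2 a' k (r + (j.1 - j'.1)) else 0) := fun r hr => by
      rw [Finset.mem_range] at hr
      rw [if_pos (by omega)]
      ring
    rw [Finset.sum_congr rfl e, Finset.sum_subset (Finset.range_mono (Nat.sub_le (m k) (j.1 - j'.1)))
      fun r _ hr => by
        rw [Finset.mem_range] at hr
        rw [if_neg (by omega), mul_zero, mul_zero], Finset.sum_range]
    refine Finset.sum_congr rfl fun r _ => ?_
    rw [← h.matrix a ⟨k, r⟩, hankelMap_apply h, show r.1 + j.1 - j'.1 = r.1 + (j.1 - j'.1) by omega]
    congr 2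
    exact if_congr (by simp only; omega) rfl rfl
  rcases le_total j'.1 j.1 with hle | hle
  · rw [toeplitzBlock, if_pos hle, key j j' a a' hle]
  · have hs : (matG n ω R * (matG n ω R)ᵀ) (j, a) (j', a') =
        (matG n ω R * (matG n ω R)ᵀ) (j', a') (j, a) := by
      simp only [mul_apply, transpose_apply, mul_comm]
    rw [hs, key j' j a' a hle, toeplitzBlock]
    split_ifs with h2
    · have : j.1 = j'.1 := le_antisymm hle h2
      rw [this, Nat.sub_self]
      exact (congrFun (congrFun column_zero_transpose a') a).symm
    · rfl

theorem blockPosDef_column (h : HoldsInput ω p R σ)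
    (hΓ : (matG n ω R * (matG n ω R)ᵀ).PosDef) :
    BlockPosDef n (toeplitzBlock ((storedData n q σ).column d)) := by
  rintro x ⟨r, hr, hx⟩
  have := (posDef_iff_dotProduct_mulVec.1 hΓ).2 (x := fun ja => x ja.1 ja.2) (fun h0 => hx (by
    ext a; exact congrFun h0 (⟨r, hr⟩, a)))
  refine this.trans_eq ?_
  rw [Finset.sum_range]
  simp only [dotProduct, Fintype.sum_prod_type, star_trivial, mulVec, gram_eq_toeplitz h]
  refine Finset.sum_congr rfl fun j _ => ?_
  rw [Finset.sum_range]
  simp only [Finset.mul_sum]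
  rw [Finset.sum_comm]

theorem gram_mulVec_multiplier (h : HoldsInput ω p R σ)
    (hΓ : (matG n ω R * (matG n ω R)ᵀ).PosDef) :
    (matG n ω R * (matG n ω R)ᵀ) *ᵥ
      (fun ja => (storedData n q σ).multiplier d ja.1 ja.2) = hankelVec p R := by
  ext ⟨j, a⟩
  have := congrFun (multiplier_solves (D := storedData n q σ) column_zero_transpose column_eq_zero
    (blockPosDef_column h hΓ) j j.2) a
  rw [rhs_eq h] at this
  refine Eq.trans ?_ ((congrFun (Finset.sum_range (n := n) _) a).symm.trans this)
  rw [Finset.sum_apply]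
  simp only [mulVec, dotProduct, Fintype.sum_prod_type, gram_eq_toeplitz h]

theorem corrected_eq (h : HoldsInput ω p R σ) (k : Fin q) (i : Fin (m k + n - 1)) :
    (storedData n q σ).corrected d k i = p ⟨k, i⟩ - (ω k)⁻¹.toReal *
      ((fun ja : Fin n × Fin d => (storedData n q σ).multiplier d ja.1 ja.2) ᵥ*
        hankelMap n R) ⟨k, i⟩ := by
  have hi := i.2
  rw [corrected]
  change σ.real 0 k i 0 - σ.real 1 k 0 0 * ∑ a : Fin d,
    ∑ t ∈ Finset.range (n - (n - (i.1 + 1)) - (i.1 + 1 - σ.int 3 k)),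
      (storedData n q σ).multiplier d (i.1 + 1 - σ.int 3 k + t) a *
        σ.real 2 a k (i.1 - (i.1 + 1 - σ.int 3 k + t)) = _
  rw [h.weight, h.size_m, ← h.data]
  congr 2
  simp only [vecMul, dotProduct, Fintype.sum_prod_type, hankelMap_apply h]
  conv_rhs => rw [Finset.sum_comm]
  refine Finset.sum_congr rfl fun a _ => ?_
  refine Eq.trans ?_ (Finset.sum_range (n := n) (fun j : ℕ =>
    (storedData n q σ).multiplier d j a *
      (if j ≤ i.1 ∧ i.1 - j < m k then σ.real 2 a k (i.1 - j) else 0 : ℝ)))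
  simp only [mul_ite, mul_zero]
  rw [← Finset.sum_filter]
  -- Only these columns j of the Hankel block contain the parameter of index `i`; there are at most
  -- min(m_k, n) of them, as the operation count needs.
  have : (Finset.range n).filter (fun j => j ≤ i.1 ∧ i.1 - j < m k) =
      Finset.Ico (i.1 + 1 - m k) (n - (n - (i.1 + 1))) := by
    ext j
    simp only [Finset.mem_filter, Finset.mem_range, Finset.mem_Ico]
    omega
  rw [this, Finset.sum_Ico_eq_sum_range]

theorem cost_eq (h : HoldsInput ω p R σ) : (storedData n q σ).cost d =
    hankelVec p R ⬝ᵥ fun ja => (storedData n q σ).multiplier d ja.1 ja.2 := by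
  change ∑ j ∈ Finset.range n,
    (storedData n q σ).rhs d j ⬝ᵥ (storedData n q σ).multiplier d j = _
  rw [Finset.sum_range]
  simp only [dotProduct, Fintype.sum_prod_type, rhs_eq h]

theorem gradEntry_eq (h : HoldsInput ω p R σ) (a : Fin d) (r : HankelRow m) :
    (storedData n q σ).gradEntry d a r.1 r.2 = 2 * ∑ j : Fin n,
      (storedData n q σ).multiplier d j a * layeredHankel m n (fun t => p t -
        (ω t.1)⁻¹.toReal * ((fun ja : Fin n × Fin d =>
          (storedData n q σ).multiplier d ja.1 ja.2) ᵥ* hankelMap n R) t) r j := by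
  refine congrArg (2 * ·) ((Finset.sum_range (n := n) _).trans ?_)
  refine Finset.sum_congr rfl fun j _ => ?_
  rw [layeredHankel, of_apply, ← corrected_eq h]

end HankelProgram

end

theorem mainTheorem4 :
    ∃ (prog : Com) (C : ℕ), ∀ (q : ℕ) (m : Fin q → ℕ) (n d : ℕ),
      1 ≤ q → (∀ k, 1 ≤ m k) → 1 ≤ n → 1 ≤ d →
      ∀ (ω : Fin q → ENNReal) (p : HankelParam m n → ℝ) (R : Matrix (Fin d) (HankelRow m) ℝ),
        (∀ k, 0 < ω k) → (matG n ω R).rank = n * d →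
        IsLeast (admissibleCosts ω p R) (ENNReal.ofReal (costFun ω p R)) ∧
        ∀ σ : Store, HoldsInput ω p R σ →
          ∃ (σ' : Store) (N : ℕ), Exec prog σ σ' N ∧
            N ≤ C * (d ^ 3 * (∑ k, m k) * n) ∧
            σ'.real 3 0 0 0 = costFun ω p R ∧
            HasGradientAt
              (fun X : EuclideanSpace ℝ (Fin d × HankelRow m) =>
                costFun ω p (Matrix.of fun a r => X (a, r)))
              (WithLp.toLp 2 fun ar : Fin d × HankelRow m =>
                σ'.real 4 ar.1 ar.2.1 ar.2.2)
              (WithLp.toLp 2 fun ar : Fin d × HankelRow m => R ar.1 ar.2) := by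
  refine ⟨HankelProgram.program, 300, fun q m n d hq hm hn hd ω p R hω hR => ?_⟩
  have hΓ := posDef_of_rank_eq hR
  have : NeZero d := ⟨by omega⟩
  refine ⟨(costFun_isLeast hω p R (y := (matG n ω R * (matG n ω R).transpose)⁻¹.mulVec
    (hankelVec p R)) ?_).1, fun σ h => ?_⟩
  · rw [Matrix.mulVec_mulVec,
      Matrix.mul_nonsing_inv _ ((Matrix.isUnit_iff_isUnit_det _).1 hΓ.isUnit), Matrix.one_mulVec]
  -- Positive definiteness of both pivots at every step is what makes all divisions of the program
  -- legitimate.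
  have hinv := schur_invariants HankelProgram.column_zero_transpose
    (HankelProgram.blockPosDef_column h hΓ)
  have hy := HankelProgram.gram_mulVec_multiplier h hΓ
  obtain ⟨σ', N, h1, h2, h3, h4⟩ := HankelProgram.program_exec
    (HankelProgram.storedData_inputOk h) hn hq
    (fun k hk => (hm ⟨k, hk⟩).trans_eq (h.size_m ⟨k, hk⟩).symm)
    (fun i hi => (hinv i hi).2.2.2.1) (fun i hi => (hinv i hi).2.2.2.2.1)
  refine ⟨σ', N, h1, ?_, ?_, ?_⟩
  · rwa [HankelProgram.storedData_rows h] at h2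
  · rw [h3, HankelProgram.cost_eq h, (costFun_isLeast hω p R hy).2]
  · convert! costFun_hasGradientAt hω p R hΓ hy using 2
    ext ar
    rw [h4 ar.2.1 ar.2.1.2 ar.2.2 (ar.2.2.2.trans_eq (h.size_m ar.2.1).symm),
      HankelProgram.gradEntry_eq h]
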